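/- Let $N\ge 4$. Let $\Sigma$ be a smooth manifold of dimension $N-1$, let $\mathcal V_\Sigma\to\Sigma$ be a smooth vector bundle of rank $N$ with a smooth fibre metric $\eta$ of signature $(N-1,1)$, and let $e\colon T\Sigma\to\mathcal V_\Sigma$ be a smooth fibrewise injective bundle map (the restriction of a coframe to the boundary). Assume that $g^\partial=\eta(e,e)$ is degenerate at every point, and let $X,Y^1,\dots,Y^{N-2}$ be a smooth frame of $T\Sigma$ with $\iota_X g^\partial=0$. Write $\Omega_\partial^{i,j}=\Omega^i(\Sigma,\bigwedge^j\mathcal V_\Sigma)$. Let $\beta\in\Omega_\partial^{1,0}$ satisfy $\iota_X\beta=1$ and, with $\widetilde e:=e-\beta\,\iota_Xe$, $$\iota_{Y^1}\cdots\iota_{Y^{N-2}}(\widetilde e\wedge e^{N-4}\wedge v)=0\quad\text{for all } v \text{ of bidegree } (1,2) \text{ with } e^{N-3}\wedge v=0 .$$ Put $\widetilde g^\partial=\eta(\widetilde e,\widetilde e)$, let $W_1^{\partial,(N-3,N-1)}(\tau)=\tau\wedge e$, let $\widetilde\varrho^{(N-3,N-1)}(\tau)=[\tau,\widetilde e]\in\Omega_\partial^{N-2,N-2}$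 (contract the last internal index of $\tau$ with $\widetilde e$ by means of $\eta$ and antisymmetrise the form indices), and let $$\mathcal S=\operatorname{Ker}W_1^{\partial,(N-3,N-1)}\cap\operatorname{Ker}\widetilde\varrho^{(N-3,N-1)}\subset\Omega_\partial^{N-3,N-1}.$$ (1) $\mathcal S$ is locally free of rank $\frac{N(N-3)}2$ over $C^\infty$, and the space of solutions of its (pointwise, algebraic) defining equations has dimension $\frac{N(N-3)}2$ at every point. (2) For each $N$ there are functions $f_{\mu_1\mu_2}$ ($1\le\mu_1<\mu_2\le N-2$) of a matrix and of further real variables, linear in the latter, such that the following holds for all data as above. Let $x^1,\dots,x^{N-1}$ be local coordinates on $\Sigma$ and let $q$ be a point of their domain at which $\partial_{N-1}$ lies in the kernel of $g^\partial$ (for instance the centre of normal coordinates, where $g^\partial=\mathrm{diag}(1,\dots,1,0)$; or any point of the domain, if the coordinates are chosen such that $\partial_{N-1}$ is null throughout). Let $e_i=e(\partial_i)$ for $i\le N-1$ and complete $e_1,\dots,e_{N-1}$ to a basis of $\mathcal V_\Sigma$ at $q$ by a vector $e_N$ that is $\eta$-orthogonal to the image of $\widetilde e$. Then an element $\tau$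 of bidegree $(N-3,N-1)$ at $q$ satisfies the defining equations of $\mathcal S$ if and only if all its components with respect to the coordinates and this basis vanish, except possibly (up to the order of the antisymmetric indices) $$Y_\mu=\tau^{N\,N-1\,\mu_1\dots\mu_{N-3}}_{\mu_1\dots\mu_{N-3}}\ \ (\{\mu_1,\dots,\mu_{N-3}\}=\{1,\dots,N-2\}\setminus\{\mu\}),\qquad X_{\mu_1}^{\mu_2}=\tau^{N\,N-1\,\mu_3\dots\mu_{N-2}\,\mu_2}_{\mu_3\dots\mu_{N-2}\,\mu_1}\ \ (\{\mu_1,\dots,\mu_{N-2}\}=\{1,\dots,N-2\}),$$ and $$\sum_{\mu=1}^{N-2}Y_\mu=0,\qquad X_{\mu_1}^{\mu_2}=f_{\mu_1\mu_2}\bigl(\widetilde g^\partial,\ (X_{\nu_2}^{\nu_1})_{\nu_1<\nu_2},\ (Y_\nu)_\nu\bigr)\quad\text{for all }\mu_1<\mu_2,$$ where $\widetilde g^\partial$ denotes the matrix $\widetilde g^\partial(\partial_i,\partial_j)$ at $q$. In particular all this holds at $q$ for the components of every $\tau\in\mathcal S$. -/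

import Mathlib

open Bundle Module
open scoped Manifold ContDiff

noncomputable section

/-! ### Linear algebra on one fibre

`T` plays the role of a tangent space of the boundary, `V` that of a fibre of the internal bundle. -/

section Fibre

/-- `⋀ⁱ T* ⊗ ⋀ʲ V` (for finite-dimensional `V`): alternating `i`-forms on `T` with values in `⋀ʲ V`,
where `⋀ʲ V` is realised as the space of alternating `j`-forms on the dual space `V*`. Thus
`τ u ξ` is the value of `τ` on the vectors `u₁, …, uᵢ` and the covectors `ξ₁, …, ξⱼ`. -/
abbrev BiForm (T V : Type*) [AddCommGroup T] [Module ℝ T] [AddCommGroup V] [Module ℝ V]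
    (i j : ℕ) : Type _ :=
  T [⋀^Fin i]→ₗ[ℝ] (Dual ℝ V [⋀^Fin j]→ₗ[ℝ] ℝ)

variable {T V : Type*} [AddCommGroup T] [Module ℝ T] [AddCommGroup V] [Module ℝ V]

/-- Exterior product of the internal parts, `⋀ʲ V ⊗ ⋀ˡ V → ⋀ʲ⁺ˡ V`. -/
def internalWedge (j l : ℕ) :
    TensorProduct ℝ (Dual ℝ V [⋀^Fin j]→ₗ[ℝ] ℝ) (Dual ℝ V [⋀^Fin l]→ₗ[ℝ] ℝ) →ₗ[ℝ]
      (Dual ℝ V [⋀^Fin (j + l)]→ₗ[ℝ] ℝ) :=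
  (AlternatingMap.domDomCongrₗ ℝ finSumFinEquiv).toLinearMap ∘ₗ
    (LinearMap.mul' ℝ ℝ).compAlternatingMapₗ ℝ ∘ₗ AlternatingMap.domCoprod'

/-- Exterior product on both the external and the internal parts (each one a sum over shuffles).
The sign `(-1) ^ (j k)` implements graded commutativity with respect to the total degree:
`a b = (-1) ^ ((i + j) (k + l)) b a`. -/
def wedge {i j k l : ℕ} (a : BiForm T V i j) (b : BiForm T V k l) : BiForm T V (i + k) (j + l) :=
  (-1 : ℝ) ^ (j * k) •
    ((internalWedge j l).compAlternatingMap (a.domCoprod b)).domDomCongr finSumFinEquiv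

theorem wedge_add_left {i j k l : ℕ} (a a' : BiForm T V i j) (b : BiForm T V k l) :
    wedge (a + a') b = wedge a b + wedge a' b := by
  have h : (a + a').domCoprod b = a.domCoprod b + a'.domCoprod b := by
    simp only [← AlternatingMap.domCoprod'_apply, TensorProduct.add_tmul, map_add]
  unfold wedge
  rw [h, ← smul_add]
  congr 1
  ext
  simp

theorem wedge_smul_left {i j k l : ℕ} (c : ℝ) (a : BiForm T V i j) (b : BiForm T V k l) :
    wedge (c • a) b = c • wedge a b := by
  have h : (c • a).domCoprod b = c • a.domCoprod b := by
    simp only [← AlternatingMap.domCoprod'_apply, ← TensorProduct.smul_tmul', map_smul]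
  unfold wedge
  rw [h, smul_comm c]
  congr 1
  ext
  simp

/-- A linear map `e : T → V` as an element of `T* ⊗ V = ⋀¹ T* ⊗ ⋀¹ V`. -/
def oneOneForm (e : T →ₗ[ℝ] V) : BiForm T V 1 1 where
  toFun u := AlternatingMap.ofSubsingleton ℝ (Dual ℝ V) ℝ 0 (Dual.eval ℝ V (e (u 0)))
  map_update_add' u a x y := by
    obtain rfl := Subsingleton.elim a 0
    ext ξ
    simp
  map_update_smul' u a c x := by
    obtain rfl := Subsingleton.elim a 0
    ext ξ
    simp
  map_eq_zero_of_eq' u a b _ hab := absurd (Subsingleton.elim a b) hab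

/-- The wedge power `eᵏ = e ∧ ⋯ ∧ e`, an element of `⋀ᵏ T* ⊗ ⋀ᵏ V`. -/
def coframePow (e : T →ₗ[ℝ] V) : (k : ℕ) → BiForm T V k k
  | 0 => AlternatingMap.constOfIsEmpty ℝ T (Fin 0)
      (AlternatingMap.constOfIsEmpty ℝ (Dual ℝ V) (Fin 0) (1 : ℝ))
  | k + 1 => wedge (coframePow e k) (oneOneForm e)

/-- The map `W_k^{(i,j)} : X ↦ X ∧ eᵏ`. -/
def wedgePowMap (e : T →ₗ[ℝ] V) (k i j : ℕ) : BiForm T V i j →ₗ[ℝ] BiForm T V (i + k) (j + k) where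
  toFun X := wedge X (coframePow e k)
  map_add' X Y := wedge_add_left X Y _
  map_smul' c X := wedge_smul_left c X _

/-- For a metric `η` on `V` and `e : T → V`, the map `ϱ^{(i,j+1)} : X ↦ [X, e]`,
`[X, e]_{μ₁…μᵢ₊₁}^{a₁…aⱼ} = ∑_k ± X_{… μ̂_k …}^{a₁…aⱼ b} η_{bc} e^c_{μ_k}`:
the last internal index of `X` is lowered by `η` and contracted with `e`, and the external indices
are antisymmetrised. (The sum over all permutations of the external indices is `i!` times
this sum over cyclic shuffles. The sign `(-1) ^ (i + j)` moves the contracted internal index of `X`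
and the external index of `e` from the first to the last position.) -/
def bracketMap (η : V →ₗ[ℝ] Dual ℝ V) (e : T →ₗ[ℝ] V) (i j : ℕ) :
    BiForm T V i (j + 1) →ₗ[ℝ] BiForm T V (i + 1) j where
  toFun X := (-1 : ℝ) ^ (i + j) • AlternatingMap.alternatizeUncurryFin
    { toFun := fun u =>
        (AlternatingMap.curryLeftLinearMap.flip (η (e u))).compAlternatingMap X
      map_add' := fun u v => by ext; simp
      map_smul' := fun c u => by ext; simp }
  map_add' X Y := by
    rw [← smul_add, ← AlternatingMap.alternatizeUncurryFin_add]
    congr 2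
  map_smul' c X := by
    rw [RingHom.id_apply, smul_comm c]
    congr 1
    rw [← AlternatingMap.alternatizeUncurryFin_smul]
    congr 1

/-- The fibre of `𝒮` for space-time dimension `N = n + 4`: the elements `τ` of `⋀ᴺ⁻³ T* ⊗ ⋀ᴺ⁻¹ V`
with `τ ∧ e = 0` and `[τ, ẽ] = 0`. -/
def degeneracyFibre (n : ℕ) (η : V →ₗ[ℝ] Dual ℝ V) (e e' : T →ₗ[ℝ] V) :
    Submodule ℝ (BiForm T V (n + 1) (n + 3)) :=
  LinearMap.ker (wedgePowMap e 1 (n + 1) (n + 3)) ⊓ LinearMap.ker (bracketMap η e' (n + 1) (n + 2))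

/-- The component `τ_{I₁…Iᵢ}^{J₁…Jⱼ}` with respect to vectors `∂_μ` of `T` and a basis
`b` of `V`. -/
def component {ι κ : Type*} {i j : ℕ} (d : ι → T) (b : Basis κ ℝ V) (τ : BiForm T V i j)
    (I : Fin i → ι) (J : Fin j → κ) : ℝ :=
  τ (fun k => d (I k)) (fun k => b.coord (J k))

/-- The lower indices of `X_μ^ν` and of `Y_ν`: the increasing sequence of all elements of
`{1, …, N-2} ∖ {ν}`, where `{1, …, N-2}` is the initial part of `{1, …, N-1}`. -/
def lowerIndices {n : ℕ} (ν : Fin (n + 2)) : Fin (n + 1) → Fin (n + 3) :=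
  fun k => (ν.succAbove k).castSucc

/-- The upper indices of `X_μ^ν` (and of `Y_ν`, for `μ = ν`): first `N`, then `N-1`, then the lower
indices of `X_μ^ν` with `ν` in the place of `μ`. -/
def upperIndices {n : ℕ} (μ ν : Fin (n + 2)) : Fin (n + 3) → Fin (n + 4) :=
  Fin.cons (Fin.last (n + 3)) (Fin.cons (Fin.last (n + 2)).castSucc
    (fun k : Fin (n + 1) => (Equiv.swap μ ν (ν.succAbove k)).castSucc.castSucc))

/-- `X_μ^ν = τ^{N N-1 μ₃ … μ_{N-2} ν}_{μ₃ … μ_{N-2} μ}`, where `μ, ν, μ₃, …, μ_{N-2}` are the numbers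
`1, …, N-2` in some order. (A permutation applied to the indices `μ₃ … μ_{N-2} μ` and to
the indices `μ₃ … μ_{N-2} ν` simultaneously does not change the component.) -/
def compX {n : ℕ} (d : Fin (n + 3) → T) (b : Basis (Fin (n + 4)) ℝ V)
    (τ : BiForm T V (n + 1) (n + 3)) (μ ν : Fin (n + 2)) : ℝ :=
  component d b τ (lowerIndices ν) (upperIndices μ ν)

/-- `Y_μ = τ^{N N-1 μ₁ … μ_{N-3}}_{μ₁ … μ_{N-3}}`, where `{μ₁, …, μ_{N-3}} = {1, …, N-2} ∖ {μ}`. -/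
def compY {n : ℕ} (d : Fin (n + 3) → T) (b : Basis (Fin (n + 4)) ℝ V)
    (τ : BiForm T V (n + 1) (n + 3)) (μ : Fin (n + 2)) : ℝ :=
  component d b τ (lowerIndices μ) (upperIndices μ μ)

/-- The component with lower indices `I` and upper indices `J` is, up to the order of the lower and
of the upper indices, one of the components `Y_μ` or `X_μ^ν`, `μ ≠ ν`. -/
def IsXYIndex {n : ℕ} (I : Fin (n + 1) → Fin (n + 3)) (J : Fin (n + 3) → Fin (n + 4)) : Prop :=
  ∃ (μ ν : Fin (n + 2)) (σ : Equiv.Perm (Fin (n + 1))) (ρ : Equiv.Perm (Fin (n + 3))),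
    I = lowerIndices ν ∘ σ ∧ J = upperIndices μ ν ∘ ρ

end Fibre

/-! ### Fields on the boundary

`M` is the boundary, a smooth manifold of dimension `N - 1 = n + 3`, and `E` the restriction to `M`
of the internal bundle, a smooth vector bundle of rank `N = n + 4`. -/

section Fields

/-- A Lorentzian metric on the vector bundle `E` and a smooth bundle map `e : TM → E`, injective on
each fibre (the restriction to the boundary of a coframe). -/
structure BoundaryCoframe (n : ℕ) (M : Type*) [TopologicalSpace M]
    [ChartedSpace (EuclideanSpace ℝ (Fin (n + 3))) M] [IsManifold (𝓡 (n + 3)) ∞ M]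
    (F : Type*) [NormedAddCommGroup F] [NormedSpace ℝ F]
    (E : M → Type*) [TopologicalSpace (TotalSpace F E)] [∀ x, AddCommGroup (E x)]
    [∀ x, Module ℝ (E x)] [∀ x, TopologicalSpace (E x)] [∀ x, IsTopologicalAddGroup (E x)]
    [∀ x, ContinuousSMul ℝ (E x)] [FiberBundle F E] [VectorBundle ℝ F E]
    [ContMDiffVectorBundle ∞ F E (𝓡 (n + 3))] where
  /-- the fibre metric `η` -/
  metric (x : M) : E x →L[ℝ] E x →L[ℝ] ℝ
  /-- `η` is symmetric of signature `(N - 1, 1)`: there is an orthonormal basis. -/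
  metric_lorentzian (x : M) : ∃ b : Basis (Fin (n + 4)) ℝ (E x), ∀ i j,
    metric x (b i) (b j) = if i = j then (if i = Fin.last (n + 3) then -1 else 1) else 0
  metric_smooth : ContMDiff (𝓡 (n + 3)) ((𝓡 (n + 3)).prod 𝓘(ℝ, F →L[ℝ] F →L[ℝ] ℝ)) ∞
    (fun x => TotalSpace.mk' (F →L[ℝ] F →L[ℝ] ℝ)
      (E := fun x => E x →L[ℝ] E x →L[ℝ] ℝ) x (metric x))
  /-- the coframe `e` -/
  coframe (x : M) : TangentSpace (𝓡 (n + 3)) x →L[ℝ] E x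
  coframe_injective (x : M) : Function.Injective (coframe x)
  coframe_smooth : ContMDiff (𝓡 (n + 3))
    ((𝓡 (n + 3)).prod 𝓘(ℝ, EuclideanSpace ℝ (Fin (n + 3)) →L[ℝ] F)) ∞
    (fun x => TotalSpace.mk' (EuclideanSpace ℝ (Fin (n + 3)) →L[ℝ] F)
      (E := fun x => TangentSpace (𝓡 (n + 3)) x →L[ℝ] E x) x (coframe x))

variable {n : ℕ} {M : Type*} [TopologicalSpace M]
  [ChartedSpace (EuclideanSpace ℝ (Fin (n + 3))) M] [IsManifold (𝓡 (n + 3)) ∞ M]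
  {F : Type*} [NormedAddCommGroup F] [NormedSpace ℝ F]
  {E : M → Type*} [TopologicalSpace (TotalSpace F E)] [∀ x, AddCommGroup (E x)]
  [∀ x, Module ℝ (E x)] [∀ x, TopologicalSpace (E x)] [∀ x, IsTopologicalAddGroup (E x)]
  [∀ x, ContinuousSMul ℝ (E x)] [FiberBundle F E] [VectorBundle ℝ F E]
  [ContMDiffVectorBundle ∞ F E (𝓡 (n + 3))]

namespace BoundaryCoframe

/-- The fibre metric as a linear map `E x → (E x)*`. -/
def metricL (D : BoundaryCoframe n M F E) (x : M) : E x →ₗ[ℝ] Dual ℝ (E x) where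
  toFun v := (D.metric x v : E x →ₗ[ℝ] ℝ)
  map_add' v w := by simp
  map_smul' c v := by simp

/-- The coframe at `x` as a linear map. -/
def coframeL (D : BoundaryCoframe n M F E) (x : M) : TangentSpace (𝓡 (n + 3)) x →ₗ[ℝ] E x :=
  (D.coframe x : TangentSpace (𝓡 (n + 3)) x →ₗ[ℝ] E x)

/-- `g^∂(u, v) = η(e u, e v)`. -/
def boundaryMetric (D : BoundaryCoframe n M F E) (x : M) (u v : TangentSpace (𝓡 (n + 3)) x) : ℝ :=
  D.metric x (D.coframe x u) (D.coframe x v)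

/-- `u` lies in the kernel of the degenerate boundary metric `g^∂`. -/
def IsNull (D : BoundaryCoframe n M F E) (x : M) (u : TangentSpace (𝓡 (n + 3)) x) : Prop :=
  ∀ v, D.boundaryMetric x u v = 0

end BoundaryCoframe

variable (n M) in
/-- A smooth vector field on `M`. -/
def IsSmoothFieldOn (U : Set M) (Z : ∀ x : M, TangentSpace (𝓡 (n + 3)) x) : Prop :=
  ContMDiffOn (𝓡 (n + 3)) (𝓡 (n + 3)).tangent ∞
    (fun x => (TotalSpace.mk' (EuclideanSpace ℝ (Fin (n + 3))) x (Z x) :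
      TangentBundle (𝓡 (n + 3)) M)) U

variable (n F) in
/-- A smooth section over `U` of the dual bundle `E*`. -/
def IsSmoothCovectorOn (U : Set M) (α : ∀ x : M, E x →L[ℝ] ℝ) : Prop :=
  ContMDiffOn (𝓡 (n + 3)) ((𝓡 (n + 3)).prod 𝓘(ℝ, F →L[ℝ] ℝ)) ∞
    (fun x => TotalSpace.mk' (F →L[ℝ] ℝ)
      (E := fun x => E x →L[ℝ] Bundle.Trivial M ℝ x) x (α x)) U

variable (n F) in
/-- Elements of `Ω_∂^{i,j} = Ωⁱ(M, ⋀ʲ E)`: `τ` is smooth if its values on all smooth local vector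
fields and all smooth local sections of `E*` are smooth functions. -/
def IsSmoothBiForm {i j : ℕ} (τ : ∀ x : M, BiForm (TangentSpace (𝓡 (n + 3)) x) (E x) i j) : Prop :=
  ∀ U : Set M, IsOpen U →
    ∀ Z : Fin i → ∀ x : M, TangentSpace (𝓡 (n + 3)) x, (∀ a, IsSmoothFieldOn n M U (Z a)) →
      ∀ α : Fin j → ∀ x : M, E x →L[ℝ] ℝ, (∀ c, IsSmoothCovectorOn n F U (α c)) →
        ContMDiffOn (𝓡 (n + 3)) 𝓘(ℝ, ℝ) ∞
          (fun x => τ x (fun a => Z a x) (fun c => (α c x : E x →ₗ[ℝ] ℝ))) U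

variable (n M) in
/-- A smooth one-form on `M`. -/
def IsSmoothOneForm (β : ∀ x : M, TangentSpace (𝓡 (n + 3)) x →L[ℝ] ℝ) : Prop :=
  ContMDiff (𝓡 (n + 3))
    ((𝓡 (n + 3)).prod 𝓘(ℝ, EuclideanSpace ℝ (Fin (n + 3)) →L[ℝ] ℝ)) ∞
    (fun x => TotalSpace.mk' (EuclideanSpace ℝ (Fin (n + 3)) →L[ℝ] ℝ)
      (E := fun x => TangentSpace (𝓡 (n + 3)) x →L[ℝ] Bundle.Trivial M ℝ x) x (β x))

/-- A smooth frame `X, Y₁, …, Y_{N-2}` of `TM` such that `X` spans the kernel of the boundary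
metric at every point; in particular the boundary is light-like. (By the Lorentzian
signature, the kernel is one-dimensional as soon as it is nonzero.) -/
structure NullFrame (D : BoundaryCoframe n M F E) where
  X (x : M) : TangentSpace (𝓡 (n + 3)) x
  Y (i : Fin (n + 2)) (x : M) : TangentSpace (𝓡 (n + 3)) x
  X_smooth : IsSmoothFieldOn n M Set.univ X
  Y_smooth (i : Fin (n + 2)) : IsSmoothFieldOn n M Set.univ (Y i)
  X_null (x : M) : D.IsNull x (X x)
  frame (x : M) : LinearIndependent ℝ
    (Fin.cons (X x) (fun i => Y i x) : Fin (n + 3) → TangentSpace (𝓡 (n + 3)) x)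

namespace NullFrame

variable {D : BoundaryCoframe n M F E}

/-- `ẽ = e - ê`, where `ê = β ⊗ ι_X e`. -/
def modifiedCoframe (R : NullFrame D) (β : ∀ x : M, TangentSpace (𝓡 (n + 3)) x →L[ℝ] ℝ) (x : M) :
    TangentSpace (𝓡 (n + 3)) x →ₗ[ℝ] E x :=
  D.coframeL x - (β x : TangentSpace (𝓡 (n + 3)) x →ₗ[ℝ] ℝ).smulRight (D.coframeL x (R.X x))

/-- The conditions that fix the one-form `β`: it is smooth, `ι_X β = 1`, and
`ι_{Y₁} ⋯ ι_{Y_{N-2}} (ẽ ∧ e^{N-4} ∧ v) = 0` for all `v` of bidegree `(1, 2)` with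
`e^{N-3} ∧ v = 0`. (The condition on `v` is algebraic, hence stated fibre by fibre.) -/
structure IsNormalising (R : NullFrame D)
    (β : ∀ x : M, TangentSpace (𝓡 (n + 3)) x →L[ℝ] ℝ) : Prop where
  smooth : IsSmoothOneForm n M β
  apply_X (x : M) : β x (R.X x) = 1
  apply_Y (x : M) (v : BiForm (TangentSpace (𝓡 (n + 3)) x) (E x) 1 2) :
    wedge (coframePow (D.coframeL x) (n + 1)) v = 0 →
      wedge (wedge (oneOneForm (R.modifiedCoframe β x)) (coframePow (D.coframeL x) n)) v
        (fun k => R.Y (Fin.cast (by omega) k) x) = 0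

/-- The modified metric `g̃^∂ = η(ẽ, ẽ)`, as a matrix with respect to tangent vectors `∂_μ`. -/
def modifiedMetric (R : NullFrame D) (β : ∀ x : M, TangentSpace (𝓡 (n + 3)) x →L[ℝ] ℝ) (x : M)
    (d : Fin (n + 3) → TangentSpace (𝓡 (n + 3)) x) : Matrix (Fin (n + 3)) (Fin (n + 3)) ℝ :=
  Matrix.of fun i j => D.metric x (R.modifiedCoframe β x (d i)) (R.modifiedCoframe β x (d j))

/-- The fibre of `𝒮` at `x`. -/
def fibreS (R : NullFrame D) (β : ∀ x : M, TangentSpace (𝓡 (n + 3)) x →L[ℝ] ℝ) (x : M) :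
    Submodule ℝ (BiForm (TangentSpace (𝓡 (n + 3)) x) (E x) (n + 1) (n + 3)) :=
  degeneracyFibre n (D.metricL x) (D.coframeL x) (R.modifiedCoframe β x)

/-- `𝒮 = Ker W_1^{∂,(N-3,N-1)} ∩ Ker ϱ̃^{(N-3,N-1)} ⊂ Ω_∂^{N-3,N-1}`. -/
def spaceS (R : NullFrame D) (β : ∀ x : M, TangentSpace (𝓡 (n + 3)) x →L[ℝ] ℝ) :
    Set (∀ x : M, BiForm (TangentSpace (𝓡 (n + 3)) x) (E x) (n + 1) (n + 3)) :=
  {τ | IsSmoothBiForm n F τ ∧ ∀ x, τ x ∈ R.fibreS β x}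

end NullFrame

/-- A space `S` of smooth forms is locally free of rank `r` over the smooth functions: near every
point there are `r` elements of `S`, linearly independent at each point, such that every element of
`S` is locally a combination of them with smooth coefficients. -/
def IsLocallyFreeOfRank {i j : ℕ}
    (S : Set (∀ x : M, BiForm (TangentSpace (𝓡 (n + 3)) x) (E x) i j)) (r : ℕ) : Prop :=
  ∀ p : M, ∃ U : Set M, IsOpen U ∧ p ∈ U ∧
    ∃ σ : Fin r → ∀ x : M, BiForm (TangentSpace (𝓡 (n + 3)) x) (E x) i j,
      (∀ k, σ k ∈ S) ∧ (∀ x ∈ U, LinearIndependent ℝ (fun k => σ k x)) ∧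
      ∀ τ ∈ S, ∃ c : Fin r → M → ℝ, (∀ k, ContMDiffOn (𝓡 (n + 3)) 𝓘(ℝ, ℝ) ∞ (c k) U) ∧
        ∀ x ∈ U, τ x = ∑ k, c k x • σ k x

/-- The coordinate vector `∂_i` at `q` of a chart `φ`. -/
def coordVector (φ : OpenPartialHomeomorph M (EuclideanSpace ℝ (Fin (n + 3)))) (q : M)
    (i : Fin (n + 3)) : TangentSpace (𝓡 (n + 3)) q :=
  mfderiv 𝓘(ℝ, EuclideanSpace ℝ (Fin (n + 3))) (𝓡 (n + 3)) φ.symm (φ q)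
    (EuclideanSpace.single i (1 : ℝ))

end Fields

end

/-!
Fix a point, a volume form `Ω` of the tangent space `T` and a volume form `W` of `V*`. The Hodge
star identifies the forms of bidegree `(N-3, N-1)` with `⋀² T ⊗ V*`. For `d = (X, Y₁, …, Y_{N-2})`,
the star of `τ` consists of covectors `P_{ij} = -P_{ji}`. The equation `[τ, ẽ] = 0` kills `P_{ij}`
for `i, j ≠ 0`, because `η(ẽ Y₁), …, η(ẽ Y_{N-2})` are linearly independent, and by Cartan's lemma
it forces `P_{0j} = ∑_ν B_{jν} η(ẽ Y_ν)` with `B` symmetric. The equation `τ ∧ e = 0` then becomes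
`tr (B G) = 0`, where `G` is the Gram matrix of `Y₁, …, Y_{N-2}` for `g^∂`. By the Lorentzian
signature `G` is definite, so that this is one nontrivial condition on the `(N-1)(N-2)/2` entries of
`B`, and all choices depend smoothly on the point.

If `e X, e Y₁, …, e Y_{N-2}` are completed to a basis of `V` by a vector `η`-orthogonal to the image
of `ẽ`, the components `X_μ^ν` and `Y_ν` of `τ` are, up to sign and a common factor, the entries
`A_{νμ}` and `A_{νν}` of `A = B G`. A matrix `A` is of this form if and only if `G A` is symmetric,
and for definite `G` this expresses the part of `A` below the diagonal linearly in terms of the part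
above it and the diagonal: a strictly triangular `L` with `G L` symmetric vanishes.
-/

/-! ### Alternating forms -/

section OneFormCoproduct

variable {R T N₁ N₂ : Type*} [CommRing R] [AddCommGroup T] [Module R T]
  [AddCommGroup N₁] [Module R N₁] [AddCommGroup N₂] [Module R N₂]

/-- The permutation of `Fin i ⊕ Fin 1 ≃ Fin (i + 1)` that moves the last index to position `k` and
keeps the order of the others; these are the shuffles of type `(i, 1)`. -/
def cyclicShuffle (i : ℕ) (k : Fin (i + 1)) : Equiv.Perm (Fin i ⊕ Fin 1) :=
  finSumFinEquiv.symm.permCongr ((finRotate (i + 1)).trans k.cycleRange.symm)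

theorem sign_cyclicShuffle (i : ℕ) (k : Fin (i + 1)) :
    Equiv.Perm.sign (cyclicShuffle i k) = (-1) ^ (i + (k : ℕ)) := by
  rw [cyclicShuffle, Equiv.Perm.sign_permCongr, Equiv.Perm.sign_trans, Equiv.Perm.sign_symm,
    Fin.sign_cycleRange, sign_finRotate, mul_comm, pow_add, Nat.add_sub_cancel]

theorem cyclicShuffle_inl (i : ℕ) (k : Fin (i + 1)) (j : Fin i) :
    cyclicShuffle i k (Sum.inl j) = finSumFinEquiv.symm (k.succAbove j) := by
  have : finRotate (i + 1) (Fin.castAdd 1 j) = j.succ := by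
    rw [finRotate_apply]
    exact Fin.coeSucc_eq_succ
  simp [cyclicShuffle, this]

theorem cyclicShuffle_inr (i : ℕ) (k : Fin (i + 1)) (j : Fin 1) :
    cyclicShuffle i k (Sum.inr j) = finSumFinEquiv.symm k := by
  have : finRotate (i + 1) (Fin.natAdd i j) = 0 := by
    obtain rfl := Subsingleton.elim j 0
    exact finRotate_last
  simp [cyclicShuffle, this]

theorem bijective_mk_cyclicShuffle (i : ℕ) :
    Function.Bijective fun k : Fin (i + 1) =>
      (Quotient.mk'' (cyclicShuffle i k) : Equiv.Perm.ModSumCongr (Fin i) (Fin 1)) := by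
  constructor
  · intro k k' h
    obtain ⟨⟨σ, ρ⟩, h⟩ := QuotientGroup.leftRel_apply.mp (Quotient.exact' h)
    have := DFunLike.congr_fun (eq_inv_mul_iff_mul_eq.mp h) (Sum.inr 0)
    simpa [cyclicShuffle_inr] using this
  · intro q
    induction q using Quotient.inductionOn' with | _ σ
    set k := finSumFinEquiv (σ (Sum.inr 0)) with hk
    have h_inr : (cyclicShuffle i k)⁻¹ (σ (Sum.inr 0)) = Sum.inr 0 := by
      rw [Equiv.Perm.inv_eq_iff_eq, cyclicShuffle_inr, hk, Equiv.symm_apply_apply]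
    refine ⟨k, Quotient.sound' (QuotientGroup.leftRel_apply.mpr ?_)⟩
    refine Equiv.Perm.mem_sumCongrHom_range_of_perm_mapsTo_inl ?_
    rintro _ ⟨j, rfl⟩
    rcases h : ((cyclicShuffle i k)⁻¹ * σ) (Sum.inl j) with j' | j'
    · exact ⟨j', rfl⟩
    · rw [Subsingleton.elim j' 0, ← h_inr] at h
      exact absurd (((cyclicShuffle i k)⁻¹ * σ).injective h) Sum.inl_ne_inr

open TensorProduct in
theorem domCoprod_oneForm_apply {i : ℕ} (a : T [⋀^Fin i]→ₗ[R] N₁) (b : T [⋀^Fin 1]→ₗ[R] N₂)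
    (u : Fin (i + 1) → T) :
    (a.domCoprod b).domDomCongr finSumFinEquiv u =
      ∑ k : Fin (i + 1), (-1 : R) ^ (i + (k : ℕ)) • (a (k.removeNth u) ⊗ₜ b fun _ => u k) := by
  change (∑ σ, AlternatingMap.domCoprod.summand a b σ) (fun x => u (finSumFinEquiv x)) = _
  rw [sum_apply]
  refine ((bijective_mk_cyclicShuffle i).sum_comp fun σ =>
    AlternatingMap.domCoprod.summand a b σ fun x => u (finSumFinEquiv x)).symm.trans ?_
  refine Finset.sum_congr rfl fun k _ => ?_
  rw [AlternatingMap.domCoprod.summand_mk'', smul_apply, sign_cyclicShuffle,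
    MultilinearMap.domDomCongr_apply, MultilinearMap.domCoprod_apply, Units.smul_def,
    ← Int.cast_smul_eq_zsmul R]
  have h_remove : k.removeNth u = fun j => u (k.succAbove j) := rfl
  simp [cyclicShuffle_inl, cyclicShuffle_inr, h_remove]

end OneFormCoproduct

section TopForms

open Matrix (vecCons)
open AlternatingMap (alternatizeUncurryFin)

theorem removeNth_succ_vecCons {T : Type*} {k : ℕ} (i : Fin (k + 1)) (x : T)
    (u : Fin (k + 1) → T) : i.succ.removeNth (vecCons x u) = vecCons x (i.removeNth u) := by
  funext j
  refine Fin.cases ?_ (fun j => ?_) j <;> simp [Fin.removeNth, vecCons]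

theorem removeNth_zero_vecCons {T : Type*} {k : ℕ} (x : T) (u : Fin k → T) :
    (0 : Fin (k + 1)).removeNth (vecCons x u) = u := by
  funext j
  simp [Fin.removeNth]

section CommRing

variable {R T N : Type*} [CommRing R] [AddCommGroup T] [Module R T] [AddCommGroup N] [Module R N]

theorem map_vecCons_removeNth {k : ℕ} (f : T [⋀^Fin (k + 1)]→ₗ[R] N) (i j : Fin (k + 1))
    (u : Fin (k + 1) → T) :
    f (vecCons (u j) (i.removeNth u)) = if j = i then (-1 : R) ^ (i : ℕ) • f u else 0 := by
  split_ifs with h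
  · rw [h, ← f.neg_one_pow_smul_map_insertNth i, Fin.insertNth_self_removeNth,
      ← Int.cast_smul_eq_zsmul R]
    simp
  · obtain ⟨l, rfl⟩ := Fin.exists_succAbove_eq h
    exact f.map_eq_zero_of_eq _ (i := 0) (j := l.succ) (by simp [Fin.removeNth])
      (Fin.succ_ne_zero l).symm

theorem map_vecCons_swap {k : ℕ} (f : T [⋀^Fin (k + 2)]→ₗ[R] N) (x y : T) (u : Fin k → T) :
    f (vecCons x (vecCons y u)) = -f (vecCons y (vecCons x u)) := by
  have h := f.curryLeft_same (x + y)
  rw [map_add f.curryLeft, AlternatingMap.curryLeft_add, LinearMap.add_apply, map_add, map_add,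
    AlternatingMap.curryLeft_same, AlternatingMap.curryLeft_same, zero_add, add_zero] at h
  exact eq_neg_of_add_eq_zero_left (DFunLike.congr_fun h u)

theorem map_vecCons_sum {k : ℕ} {ι : Type*} (f : T [⋀^Fin (k + 1)]→ₗ[R] N) (s : Finset ι)
    (a : ι → R) (v : ι → T) (u : Fin k → T) :
    f (vecCons (∑ i ∈ s, a i • v i) u) = ∑ i ∈ s, a i • f (vecCons (v i) u) := by
  have h := f.map_update_sum s 0 (fun i => a i • v i) (vecCons 0 u)
  simp only [vecCons, Fin.update_cons_zero] at h
  exact h.trans (Finset.sum_congr rfl fun i _ => f.toMultilinearMap.cons_smul u (a i) (v i))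

/-- The exterior product of a one-form and a form. -/
def oneFormWedge {k : ℕ} (φ : Dual R T) (f : T [⋀^Fin k]→ₗ[R] N) : T [⋀^Fin (k + 1)]→ₗ[R] N :=
  alternatizeUncurryFin (φ.smulRight f)

theorem oneFormWedge_vecCons {k : ℕ} (φ : Dual R T) (f : T [⋀^Fin (k + 1)]→ₗ[R] N) (x : T)
    (u : Fin (k + 1) → T) :
    oneFormWedge φ f (vecCons x u) =
      φ x • f u -
        ∑ i : Fin (k + 1), (-1 : R) ^ (i : ℕ) • φ (u i) • f (vecCons x (i.removeNth u)) := by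
  rw [oneFormWedge, AlternatingMap.alternatizeUncurryFin_apply, Fin.sum_univ_succ, sub_eq_add_neg,
    ← Finset.sum_neg_distrib]
  congr 1
  · simp
  · refine Finset.sum_congr rfl fun i _ => ?_
    simp only [removeNth_succ_vecCons, ← Int.cast_smul_eq_zsmul R, Fin.val_succ, pow_succ]
    simp

variable {ι : Type*} [Fintype ι]

/-- The term `k + 1` comes from `∑ⱼ dʲ ∧ ι_{dⱼ} f = (deg f) f`. -/
theorem sum_oneFormWedge_coord {k : ℕ} (d : Basis ι R T) (f : T [⋀^Fin (k + 1)]→ₗ[R] N)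
    (u : Fin (k + 1) → T) :
    ∑ j, oneFormWedge (d.coord j) f (vecCons (d j) u) = ((Fintype.card ι : R) - (k + 1)) • f u := by
  have h_slot (i : Fin (k + 1)) :
      ∑ j, (-1 : R) ^ (i : ℕ) • d.coord j (u i) • f (vecCons (d j) (i.removeNth u)) = f u := by
    rw [← Finset.smul_sum, ← map_vecCons_sum]
    simp only [Basis.coord_apply, d.sum_repr, map_vecCons_removeNth, if_true, smul_smul, ← mul_pow]
    simp
  simp only [oneFormWedge_vecCons, Finset.sum_sub_distrib]
  rw [Finset.sum_comm, sub_smul, Finset.sum_congr rfl fun i _ => h_slot i]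
  congr 1 <;> simp [← Nat.cast_smul_eq_nsmul R, add_smul]

theorem alternatingMap_eq_zero_of_card_lt {k : ℕ} (d : Basis ι R T) (h : Fintype.card ι < k)
    (f : T [⋀^Fin k]→ₗ[R] N) : f = 0 := by
  refine Basis.ext_alternating d fun v hv => ?_
  have := Fintype.card_le_of_injective v hv
  rw [Fintype.card_fin] at this
  omega

/-- Cramer's rule: a one-form times a form of top degree vanishes. -/
theorem sum_removeNth_of_card_le {k : ℕ} (d : Basis ι R T) (h : Fintype.card ι ≤ k + 1)
    (f : T [⋀^Fin (k + 1)]→ₗ[R] N) (φ : Dual R T) (x : T) (u : Fin (k + 1) → T) :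
    ∑ i : Fin (k + 1), (-1 : R) ^ (i : ℕ) • φ (u i) • f (vecCons x (i.removeNth u)) =
      φ x • f u := by
  have h_wedge := oneFormWedge_vecCons φ f x u
  rw [alternatingMap_eq_zero_of_card_lt d (Nat.lt_succ_of_le h) (oneFormWedge φ f),
    AlternatingMap.zero_apply, eq_comm, sub_eq_zero] at h_wedge
  exact h_wedge.symm

theorem sum_removeNth_vecCons_of_card_le {k : ℕ} (d : Basis ι R T) (h : Fintype.card ι ≤ k + 2)
    (f : T [⋀^Fin (k + 2)]→ₗ[R] N) (φ : Dual R T) (x y : T) (u : Fin (k + 1) → T) :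
    ∑ i : Fin (k + 1), (-1 : R) ^ (i : ℕ) • φ (u i) • f (vecCons x (vecCons y (i.removeNth u))) =
      φ y • f (vecCons x u) - φ x • f (vecCons y u) := by
  have h := sum_removeNth_of_card_le d h f φ x (vecCons y u)
  rw [Fin.sum_univ_succ] at h
  simp only [removeNth_succ_vecCons, removeNth_zero_vecCons, Fin.val_succ, pow_succ, Fin.val_zero,
    pow_zero, one_smul, Matrix.cons_val_zero, Matrix.cons_val_succ, mul_neg, mul_one, neg_smul,
    Finset.sum_neg_distrib] at h
  rw [← h]
  abel

end CommRing

section Field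

variable {K T N : Type*} [Field K] [AddCommGroup T] [Module K T] [AddCommGroup N] [Module K N]

theorem eq_zero_of_map_vecCons_eq_zero {m : ℕ} (d : Basis (Fin (m + 1)) K T)
    {Ω : T [⋀^Fin (m + 1)]→ₗ[K] K} (hΩ : Ω ≠ 0) {x : T} (h : ∀ u, Ω (vecCons x u) = 0) :
    x = 0 := by
  obtain ⟨u, hu⟩ := DFunLike.ne_iff.mp hΩ
  refine (Module.forall_dual_apply_eq_zero_iff K x).mp fun φ => ?_
  have := sum_removeNth_of_card_le d (Fintype.card_fin _).le Ω φ x u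
  simp only [h, smul_eq_mul, mul_zero, Finset.sum_const_zero] at this
  exact (mul_eq_zero.mp this.symm).resolve_right hu

theorem eq_map_smul_of_top {ι : Type*} [Finite ι] (d : Basis ι K T)
    (Ω : T [⋀^ι]→ₗ[K] K) (hΩ : Ω d ≠ 0) (f : T [⋀^ι]→ₗ[K] N) (u : ι → T) :
    f u = Ω u • (Ω d)⁻¹ • f d := by
  classical
  have := Fintype.ofFinite ι
  suffices f = (LinearMap.toSpanSingleton K N ((Ω d)⁻¹ • f d)).compAlternatingMap Ω from
    DFunLike.congr_fun this u
  refine Basis.ext_alternating d fun v hv => ?_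
  let σ : Equiv.Perm ι := Equiv.ofBijective v (Finite.injective_iff_bijective.mp hv)
  change f (d ∘ σ) = Ω (d ∘ σ) • (Ω d)⁻¹ • f d
  rw [f.map_perm, Ω.map_perm, Units.smul_def, Units.smul_def, smul_assoc, smul_smul,
    mul_inv_cancel₀ hΩ, one_smul]

theorem exists_eq_sum_of_codim_one {m : ℕ} (d : Basis (Fin (m + 2)) K T)
    (Ω : T [⋀^Fin (m + 2)]→ₗ[K] K) (hΩ : Ω d ≠ 0) (f : T [⋀^Fin (m + 1)]→ₗ[K] N) :
    ∃ c : Fin (m + 2) → N, ∀ u, f u = ∑ i, Ω (vecCons (d i) u) • c i := by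
  refine ⟨fun j => (Ω d)⁻¹ • oneFormWedge (d.coord j) f d, fun u => ?_⟩
  have h := sum_oneFormWedge_coord d f u
  rw [Fintype.card_fin, show ((m + 2 : ℕ) : K) - (m + 1) = 1 by push_cast; ring, one_smul] at h
  rw [← h]
  exact Finset.sum_congr rfl fun j _ => eq_map_smul_of_top d Ω hΩ _ _

theorem exists_eq_curryLeft_of_codim_one {m : ℕ} (d : Basis (Fin (m + 2)) K T)
    (Ω : T [⋀^Fin (m + 2)]→ₗ[K] K) (hΩ : Ω d ≠ 0) (f : T [⋀^Fin (m + 1)]→ₗ[K] K) :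
    ∃ x : T, f = Ω.curryLeft x := by
  obtain ⟨c, hc⟩ := exists_eq_sum_of_codim_one d Ω hΩ f
  refine ⟨∑ i, c i • d i, AlternatingMap.ext fun u => ?_⟩
  rw [AlternatingMap.curryLeft_apply_apply, map_vecCons_sum, hc]
  exact Finset.sum_congr rfl fun i _ => mul_comm _ _

theorem exists_eq_sum_of_codim_two [NeZero (2 : K)] {m : ℕ} (d : Basis (Fin (m + 3)) K T)
    (Ω : T [⋀^Fin (m + 3)]→ₗ[K] K) (hΩ : Ω d ≠ 0) (f : T [⋀^Fin (m + 1)]→ₗ[K] N) :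
    ∃ c : Fin (m + 3) → Fin (m + 3) → N,
      ∀ u, f u = ∑ i, ∑ j, Ω (vecCons (d i) (vecCons (d j) u)) • c i j := by
  choose c hc using fun j => exists_eq_sum_of_codim_one d Ω hΩ (oneFormWedge (d.coord j) f)
  refine ⟨fun i j => (2 : K)⁻¹ • c j i, fun u => ?_⟩
  have h := sum_oneFormWedge_coord d f u
  rw [Fintype.card_fin, show ((m + 3 : ℕ) : K) - (m + 1) = 2 by push_cast; ring] at h
  rw [eq_inv_smul_iff₀ two_ne_zero |>.mpr h.symm, Finset.sum_comm]
  simp only [hc, Finset.smul_sum, smul_comm (2 : K)⁻¹]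

/-- Contracting with `φ ∧ ·` (Cramer's rule) turns the hypothesis into `ι_z Ω = 0` for
`z = ∑ⱼ φ(yⱼ) xⱼ - φ(xⱼ) yⱼ`. -/
theorem sum_smul_comm_of_sum_map_vecCons_eq_zero {m : ℕ} (d : Basis (Fin (m + 2)) K T)
    {Ω : T [⋀^Fin (m + 2)]→ₗ[K] K} (hΩ : Ω ≠ 0) {ι : Type*} (s : Finset ι) (x y : ι → T)
    (h : ∀ u, ∑ j ∈ s, Ω (vecCons (x j) (vecCons (y j) u)) = 0) (φ : Dual K T) :
    ∑ j ∈ s, φ (y j) • x j = ∑ j ∈ s, φ (x j) • y j := by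
  refine sub_eq_zero.mp (eq_zero_of_map_vecCons_eq_zero d hΩ fun u => ?_)
  calc Ω (vecCons (∑ j ∈ s, φ (y j) • x j - ∑ j ∈ s, φ (x j) • y j) u)
      = ∑ j ∈ s, (φ (y j) • Ω (vecCons (x j) u) - φ (x j) • Ω (vecCons (y j) u)) := by
        rw [Finset.sum_sub_distrib, ← map_vecCons_sum, ← map_vecCons_sum,
          ← AlternatingMap.curryLeft_apply_apply, map_sub]
        rfl
    _ = ∑ j ∈ s, ∑ i : Fin (m + 1), (-1 : K) ^ (i : ℕ) • φ (u i) •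
          Ω (vecCons (x j) (vecCons (y j) (i.removeNth u))) :=
        Finset.sum_congr rfl fun j _ =>
          (sum_removeNth_vecCons_of_card_le d (Fintype.card_fin _).le Ω φ (x j) (y j) u).symm
    _ = 0 := by
        rw [Finset.sum_comm]
        simp only [← Finset.smul_sum, h, smul_zero, Finset.sum_const_zero]

end Field

end TopForms

/-! ### Cartan's lemma -/

section Symmetry

theorem sum_sum_eq_zero_of_antisymm {ι M : Type*} [AddCommGroup M] [IsAddTorsionFree M]
    (s : Finset ι) (f : ι → ι → M) (h : ∀ i j, f i j = -f j i) : ∑ i ∈ s, ∑ j ∈ s, f i j = 0 := by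
  refine self_eq_neg.mp ?_
  calc ∑ i ∈ s, ∑ j ∈ s, f i j = ∑ j ∈ s, ∑ i ∈ s, f i j := Finset.sum_comm
    _ = ∑ j ∈ s, ∑ i ∈ s, -f j i := by simp only [← h]
    _ = -∑ i ∈ s, ∑ j ∈ s, f i j := by simp only [Finset.sum_neg_distrib]

theorem eq_zero_of_antisymm_of_symm {ι M : Type*} [AddCommGroup M] [IsAddTorsionFree M]
    (b : ι → ι → ι → M) (h_anti : ∀ i j k, b i j k = -b j i k)
    (h_symm : ∀ i j k, b i j k = b i k j) (i j k : ι) : b i j k = 0 := by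
  refine self_eq_neg.mp ?_
  calc b i j k = -b j i k := h_anti i j k
    _ = b k j i := by rw [h_symm j i k, h_anti j k i, neg_neg]
    _ = -b i k j := by rw [h_symm k j i, h_anti k i j]
    _ = -b i j k := by rw [h_symm i k j]

variable {K E ι : Type*} [Field K] [AddCommGroup E] [Module K E]

theorem exists_dual_family [Finite ι] [DecidableEq ι] {θ : ι → E} (hθ : LinearIndependent K θ) :
    ∃ φ : ι → Dual K E, ∀ i j, φ i (θ j) = if i = j then 1 else 0 := by
  have := Fintype.ofFinite ι
  obtain ⟨g, hg⟩ := (Fintype.linearCombination K θ).exists_leftInverse_of_injective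
    (LinearMap.ker_eq_bot.mpr hθ.fintypeLinearCombination_injective)
  refine ⟨fun i => LinearMap.proj i ∘ₗ g, fun i j => ?_⟩
  have := congr_fun (LinearMap.congr_fun hg (Pi.single j 1)) i
  simpa [Pi.single_apply] using this

/-- Cartan's lemma; the hypothesis says that `∑ⱼ αⱼ ⊗ θⱼ` is symmetric, i.e. `∑ⱼ αⱼ ∧ θⱼ = 0`. -/
theorem exists_isSymm_of_sum_smul_comm [Fintype ι] {θ α : ι → E} (hθ : LinearIndependent K θ)
    (h : ∀ φ : Dual K E, ∑ j, φ (θ j) • α j = ∑ j, φ (α j) • θ j) :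
    ∃ B : Matrix ι ι K, B.IsSymm ∧ ∀ j, α j = ∑ ν, B j ν • θ ν := by
  classical
  obtain ⟨φ, hφ⟩ := exists_dual_family hθ
  have hα (j : ι) : α j = ∑ ν, φ j (α ν) • θ ν := by simpa [hφ] using h (φ j)
  refine ⟨Matrix.of fun j ν => φ j (α ν), Matrix.IsSymm.ext fun j ν => ?_, hα⟩
  simpa [hφ] using congrArg (φ ν) (hα j)

end Symmetry

/-! ### Hodge duals -/

section Star

open Matrix (vecCons)

variable {T V : Type*} [AddCommGroup T] [Module ℝ T] [AddCommGroup V] [Module ℝ V]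

theorem alternatingMap_sum_apply {R M N ι κ : Type*} [CommRing R] [AddCommGroup M] [Module R M]
    [AddCommGroup N] [Module R N] (s : Finset ι) (g : ι → M [⋀^κ]→ₗ[R] N) (u : κ → M) :
    (∑ i ∈ s, g i) u = ∑ i ∈ s, g i u :=
  map_sum (AddMonoidHom.mk' (fun f : M [⋀^κ]→ₗ[R] N => f u) fun _ _ => rfl) g s

theorem biForm_sum_apply {i j : ℕ} {ι : Type*} (s : Finset ι) (τ : ι → BiForm T V i j)
    (u : Fin i → T) (ξ : Fin j → Dual ℝ V) : (∑ a ∈ s, τ a) u ξ = ∑ a ∈ s, τ a u ξ := by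
  rw [alternatingMap_sum_apply, alternatingMap_sum_apply]

theorem wedge_apply_of_degree_one_one {i j : ℕ} (a : BiForm T V i j) (b : BiForm T V 1 1)
    (u : Fin (i + 1) → T) (ξ : Fin (j + 1) → Dual ℝ V) :
    wedge a b u ξ = (-1 : ℝ) ^ i * ∑ k : Fin (i + 1), (-1 : ℝ) ^ (k : ℕ) *
      ∑ l : Fin (j + 1), (-1 : ℝ) ^ (l : ℕ) *
        (a (k.removeNth u) (l.removeNth ξ) * b (fun _ => u k) (fun _ => ξ l)) := by
  have h_wedge : wedge a b u = (-1 : ℝ) ^ (j * 1) • internalWedge j 1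
      ((a.domCoprod b).domDomCongr finSumFinEquiv u) := rfl
  have h_internal (x : Dual ℝ V [⋀^Fin j]→ₗ[ℝ] ℝ) (y : Dual ℝ V [⋀^Fin 1]→ₗ[ℝ] ℝ) :
      internalWedge j 1 (TensorProduct.tmul ℝ x y) ξ = LinearMap.mul' ℝ ℝ
        ((x.domCoprod y).domDomCongr finSumFinEquiv ξ) := rfl
  have h_sq : ((-1 : ℝ) ^ j) * (-1) ^ j = 1 := by simp [← mul_pow]
  rw [h_wedge, domCoprod_oneForm_apply, map_sum, AlternatingMap.smul_apply,
    alternatingMap_sum_apply]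
  simp only [map_smul, AlternatingMap.smul_apply, h_internal, domCoprod_oneForm_apply, map_sum,
    LinearMap.mul'_apply, smul_eq_mul, mul_one, pow_add, Finset.mul_sum]
  refine Finset.sum_congr rfl fun k _ => Finset.sum_congr rfl fun l _ => ?_
  linear_combination ((-1) ^ i * ((-1) ^ (k : ℕ) * ((-1) ^ (l : ℕ) *
    (a (k.removeNth u) (l.removeNth ξ) * b (fun _ => u k) (fun _ => ξ l))))) * h_sq

theorem coframePow_one_apply (e : T →ₗ[ℝ] V) (u : Fin 1 → T) (ξ : Fin 1 → Dual ℝ V) :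
    coframePow e 1 u ξ = ξ 0 (e (u 0)) := by
  change wedge (coframePow e 0) (oneOneForm e) u ξ = _
  rw [wedge_apply_of_degree_one_one]
  simp [coframePow, oneOneForm]

theorem bracketMap_apply {i j : ℕ} (η : V →ₗ[ℝ] Dual ℝ V) (e : T →ₗ[ℝ] V)
    (τ : BiForm T V i (j + 1)) (u : Fin (i + 1) → T) (ξ : Fin j → Dual ℝ V) :
    bracketMap η e i j τ u ξ = (-1 : ℝ) ^ (i + j) * ∑ k : Fin (i + 1), (-1 : ℝ) ^ (k : ℕ) *
      τ (k.removeNth u) (vecCons (η (e (u k))) ξ) := by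
  simp only [bracketMap, LinearMap.coe_mk, AddHom.coe_mk, AlternatingMap.smul_apply,
    AlternatingMap.alternatizeUncurryFin_apply, alternatingMap_sum_apply, smul_eq_mul,
    ← Int.cast_smul_eq_zsmul ℝ]
  push_cast
  rfl

/-- The form `(ι_y ι_x Ω) ⊗ (ι_θ W)` for forms `Ω` on `T` and `W` on `V*`, as a function of `θ`. If
`Ω` and `W` are volume forms, this is the Hodge dual of `(x ∧ y) ⊗ θ`. -/
def starForm {i j : ℕ} (Ω : T [⋀^Fin (i + 2)]→ₗ[ℝ] ℝ) (W : Dual ℝ V [⋀^Fin (j + 1)]→ₗ[ℝ] ℝ)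
    (x y : T) : Dual ℝ V →ₗ[ℝ] BiForm T V i j where
  toFun θ := (LinearMap.toSpanSingleton ℝ _ (W.curryLeft θ)).compAlternatingMap
    ((Ω.curryLeft x).curryLeft y)
  map_add' θ θ' := by ext; simp
  map_smul' c θ := by ext; simp [mul_left_comm]

section StarForm

variable {i j : ℕ} (Ω : T [⋀^Fin (i + 2)]→ₗ[ℝ] ℝ) (W : Dual ℝ V [⋀^Fin (j + 1)]→ₗ[ℝ] ℝ)

theorem starForm_apply (x y : T) (θ : Dual ℝ V) (u : Fin i → T) (ξ : Fin j → Dual ℝ V) :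
    starForm Ω W x y θ u ξ = Ω (vecCons x (vecCons y u)) * W (vecCons θ ξ) := rfl

theorem starForm_swap (x y : T) (θ : Dual ℝ V) :
    starForm Ω W x y θ = starForm Ω W y x (-θ) := by
  ext u ξ
  rw [map_neg]
  simp only [AlternatingMap.neg_apply, starForm_apply, map_vecCons_swap Ω x y, neg_mul]

theorem sum_starForm_vecCons {k : ℕ} (x : T) (Y : Fin k → T)
    (P : Fin (k + 1) → Fin (k + 1) → Dual ℝ V)
    (hP : ∀ a b : Fin k, P a.succ b.succ = P b.succ a.succ) :
    ∑ a, ∑ b, starForm Ω W (vecCons x Y a) (vecCons x Y b) (P a b) =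
      ∑ b : Fin k, starForm Ω W x (Y b) (P 0 b.succ - P b.succ 0) := by
  have h_zero : starForm Ω W x x (P 0 0) = 0 := by
    ext u ξ
    exact (congrArg (· * _) (DFunLike.congr_fun (Ω.curryLeft_same x) u)).trans (zero_mul _)
  have h_succ : ∑ a : Fin k, ∑ b : Fin k, starForm Ω W (Y a) (Y b) (P a.succ b.succ) = 0 := by
    ext u ξ
    simp only [biForm_sum_apply]
    exact sum_sum_eq_zero_of_antisymm _ _ fun a b => by rw [starForm_swap, hP, map_neg]; rfl
  simp only [Fin.sum_univ_succ, Matrix.cons_val_zero, Matrix.cons_val_succ, h_zero,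
    Finset.sum_add_distrib, h_succ, sub_eq_add_neg, map_add, ← starForm_swap]
  abel

theorem wedgePowMap_one_starForm (d : Basis (Fin (i + 2)) ℝ T)
    (c : Basis (Fin (j + 1)) ℝ (Dual ℝ V)) (e : T →ₗ[ℝ] V) (x y : T) (θ : Dual ℝ V)
    (u : Fin (i + 1) → T) (ξ : Fin (j + 1) → Dual ℝ V) :
    wedgePowMap e 1 i j (starForm Ω W x y θ) u ξ = (-1 : ℝ) ^ i *
      (W ξ * (θ (e y) * Ω (vecCons x u) - θ (e x) * Ω (vecCons y u))) := by
  have h_internal (k : Fin (i + 1)) : ∑ l : Fin (j + 1), (-1 : ℝ) ^ (l : ℕ) *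
      (starForm Ω W x y θ (k.removeNth u) (l.removeNth ξ) *
        coframePow e 1 (fun _ => u k) (fun _ => ξ l)) =
      W ξ * (θ (e (u k)) * Ω (vecCons x (vecCons y (k.removeNth u)))) := by
    have h := sum_removeNth_of_card_le c (Fintype.card_fin _).le W (Dual.eval ℝ V (e (u k))) θ ξ
    simp only [smul_eq_mul, Dual.eval_apply] at h
    rw [mul_left_comm, ← mul_assoc, ← h, Finset.sum_mul]
    refine Finset.sum_congr rfl fun l _ => ?_
    rw [starForm_apply, coframePow_one_apply]
    ring
  have h_external := sum_removeNth_vecCons_of_card_le d (Fintype.card_fin _).le Ω (θ ∘ₗ e) x y u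
  simp only [smul_eq_mul, LinearMap.comp_apply] at h_external
  change wedge (starForm Ω W x y θ) (coframePow e 1) u ξ = _
  rw [wedge_apply_of_degree_one_one, ← h_external, Finset.mul_sum (a := W ξ)]
  simp only [h_internal, mul_left_comm]

theorem wedgePowMap_one_sum_starForm_eq_zero_iff (d : Basis (Fin (i + 2)) ℝ T)
    (c : Basis (Fin (j + 1)) ℝ (Dual ℝ V)) (hΩ : Ω ≠ 0) (hW : W ≠ 0) (e : T →ₗ[ℝ] V)
    (P : Fin (i + 2) → Fin (i + 2) → Dual ℝ V) :
    wedgePowMap e 1 i j (∑ a, ∑ b, starForm Ω W (d a) (d b) (P a b)) = 0 ↔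
      ∀ a, ∑ b, (P a b - P b a) (e (d b)) = 0 := by
  have h_apply (u : Fin (i + 1) → T) (ξ : Fin (j + 1) → Dual ℝ V) :
      wedgePowMap e 1 i j (∑ a, ∑ b, starForm Ω W (d a) (d b) (P a b)) u ξ =
        (-1) ^ i * (W ξ * Ω (vecCons (∑ a, (∑ b, (P a b - P b a) (e (d b))) • d a) u)) := by
    simp only [map_vecCons_sum]
    simp only [map_sum, biForm_sum_apply, wedgePowMap_one_starForm Ω W d c,
      ← Finset.mul_sum, Finset.sum_sub_distrib, LinearMap.sub_apply, smul_eq_mul, sub_mul,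
      Finset.sum_mul]
    rw [Finset.sum_comm (f := fun a b => P a b (e (d a)) * _)]
  constructor
  · intro h
    refine Fintype.linearIndependent_iff.mp d.linearIndependent _
      (eq_zero_of_map_vecCons_eq_zero d hΩ fun u => ?_)
    obtain ⟨ξ, hξ⟩ := DFunLike.ne_iff.mp hW
    have := h_apply u ξ
    rw [h, eq_comm] at this
    exact (mul_eq_zero.mp ((mul_eq_zero.mp this).resolve_left (by simp))).resolve_left hξ
  · intro h
    ext u ξ
    rw [h_apply]
    simp only [h, zero_smul, Finset.sum_const_zero]
    rw [Ω.map_coord_zero (i := 0) rfl, mul_zero, mul_zero]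
    rfl

end StarForm

section Bracket

variable {i j : ℕ} (Ω : T [⋀^Fin (i + 2)]→ₗ[ℝ] ℝ) (W : Dual ℝ V [⋀^Fin (j + 2)]→ₗ[ℝ] ℝ)
  (η : V →ₗ[ℝ] Dual ℝ V) (e : T →ₗ[ℝ] V)

theorem bracketMap_starForm (d : Basis (Fin (i + 2)) ℝ T) (x y : T) (θ : Dual ℝ V)
    (u : Fin (i + 1) → T) (ξ : Fin j → Dual ℝ V) :
    bracketMap η e i j (starForm Ω W x y θ) u ξ = (-1 : ℝ) ^ (i + j) *
      (W (vecCons θ (vecCons (η (e y)) ξ)) * Ω (vecCons x u) -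
        W (vecCons θ (vecCons (η (e x)) ξ)) * Ω (vecCons y u)) := by
  let φ : Dual ℝ T :=
    { toFun := fun z => (W.curryLeft θ).curryLeft (η (e z)) ξ
      map_add' := fun z z' => by simp
      map_smul' := fun r z => by simp }
  refine (bracketMap_apply η e _ u ξ).trans (congrArg _ ?_)
  refine Eq.trans ?_ (sum_removeNth_vecCons_of_card_le d (Fintype.card_fin _).le Ω φ x y u)
  exact Finset.sum_congr rfl fun k _ => congrArg _ (mul_comm _ _)

theorem bracketMap_sum_starForm_eq_zero_iff (d : Basis (Fin (i + 2)) ℝ T) (hΩ : Ω ≠ 0)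
    (P : Fin (i + 2) → Fin (i + 2) → Dual ℝ V) :
    bracketMap η e i j (∑ a, ∑ b, starForm Ω W (d a) (d b) (P a b)) = 0 ↔
      ∀ a ξ, ∑ b, W (vecCons (P a b - P b a) (vecCons (η (e (d b))) ξ)) = 0 := by
  have h_apply (u : Fin (i + 1) → T) (ξ : Fin j → Dual ℝ V) :
      bracketMap η e i j (∑ a, ∑ b, starForm Ω W (d a) (d b) (P a b)) u ξ =
        (-1) ^ (i + j) * Ω (vecCons
          (∑ a, (∑ b, W (vecCons (P a b - P b a) (vecCons (η (e (d b))) ξ))) • d a) u) := by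
    simp only [map_vecCons_sum]
    simp only [map_sum, biForm_sum_apply, bracketMap_starForm Ω W η e d,
      ← Finset.mul_sum, Finset.sum_sub_distrib, ← W.curryLeft_apply_apply, map_sub,
      AlternatingMap.sub_apply, smul_eq_mul, sub_mul, Finset.sum_mul]
    rw [Finset.sum_comm (f := fun a b => (W.curryLeft (P a b)) (vecCons (η (e (d a))) ξ) * _)]
  constructor
  · intro h a ξ
    refine Fintype.linearIndependent_iff.mp d.linearIndependent
      (fun a => ∑ b, W (vecCons (P a b - P b a) (vecCons (η (e (d b))) ξ)))
      (eq_zero_of_map_vecCons_eq_zero d hΩ fun u => ?_) a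
    have := h_apply u ξ
    rw [h, eq_comm] at this
    exact (mul_eq_zero.mp this).resolve_left (by simp)
  · intro h
    ext u ξ
    rw [h_apply]
    simp only [h, zero_smul, Finset.sum_const_zero]
    rw [Ω.map_coord_zero (i := 0) rfl, mul_zero]
    rfl

end Bracket

theorem exists_eq_sum_starForm {i j : ℕ} (d : Basis (Fin (i + 3)) ℝ T)
    (c : Basis (Fin (j + 2)) ℝ (Dual ℝ V)) (Ω : T [⋀^Fin (i + 3)]→ₗ[ℝ] ℝ) (hΩ : Ω ≠ 0)
    (W : Dual ℝ V [⋀^Fin (j + 2)]→ₗ[ℝ] ℝ) (hW : W ≠ 0) (τ : BiForm T V (i + 1) (j + 1)) :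
    ∃ P : Fin (i + 3) → Fin (i + 3) → Dual ℝ V,
      τ = ∑ a, ∑ b, starForm Ω W (d a) (d b) (P a b) := by
  obtain ⟨m, hm⟩ := exists_eq_sum_of_codim_two d Ω ((Ω.map_basis_ne_zero_iff d).mpr hΩ) τ
  choose P hP using fun a b =>
    exists_eq_curryLeft_of_codim_one c W ((W.map_basis_ne_zero_iff c).mpr hW) (m a b)
  refine ⟨P, AlternatingMap.ext fun u => AlternatingMap.ext fun ξ => ?_⟩
  simp only [hm, alternatingMap_sum_apply, hP]
  rfl

end Star

section DegeneracyFibre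

open Matrix (vecCons)

variable {T V : Type*} [AddCommGroup T] [Module ℝ T] [AddCommGroup V] [Module ℝ V]

/-- The Hodge dual `∑_jν B_jν (ι_{Y_j} ι_x Ω) ⊗ (ι_{θ_ν} W)` of `∑_jν B_jν (x ∧ Y_j) ⊗ θ_ν`, as a
function of the matrix `B`. -/
def starSum {ι : Type*} [Fintype ι] {i j : ℕ} (Ω : T [⋀^Fin (i + 2)]→ₗ[ℝ] ℝ)
    (W : Dual ℝ V [⋀^Fin (j + 1)]→ₗ[ℝ] ℝ) (x : T) (Y : ι → T) (θ : ι → Dual ℝ V) :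
    Matrix ι ι ℝ →ₗ[ℝ] BiForm T V i j where
  toFun B := ∑ a, starForm Ω W x (Y a) (∑ ν, B a ν • θ ν)
  map_add' B B' := by
    simp only [Matrix.add_apply, add_smul, Finset.sum_add_distrib, map_add]
  map_smul' r B := by
    simp only [Matrix.smul_apply, smul_assoc, ← Finset.smul_sum, map_smul, RingHom.id_apply]

section StarSum

variable {ι : Type*} [Fintype ι] {i j : ℕ} (Ω : T [⋀^Fin (i + 2)]→ₗ[ℝ] ℝ)
  (W : Dual ℝ V [⋀^Fin (j + 1)]→ₗ[ℝ] ℝ) (x : T) (Y : ι → T) (θ : ι → Dual ℝ V)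

theorem starSum_eq_sum (B : Matrix ι ι ℝ) :
    starSum Ω W x Y θ B = ∑ a, starForm Ω W x (Y a) (∑ ν, B a ν • θ ν) := rfl

theorem starSum_apply (B : Matrix ι ι ℝ) (u : Fin i → T) (ξ : Fin j → Dual ℝ V) :
    starSum Ω W x Y θ B u ξ =
      ∑ a, ∑ ν, B a ν * (Ω (vecCons x (vecCons (Y a) u)) * W (vecCons (θ ν) ξ)) := by
  simp only [starSum_eq_sum, biForm_sum_apply, starForm_apply, map_vecCons_sum, smul_eq_mul,
    Finset.mul_sum, mul_left_comm]

end StarSum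

variable {n : ℕ} {d : Basis (Fin (n + 3)) ℝ T} {x : T} {Y : Fin (n + 2) → T}
  (hd : ⇑d = vecCons x Y) (c : Basis (Fin (n + 4)) ℝ (Dual ℝ V))
  {Ω : T [⋀^Fin (n + 3)]→ₗ[ℝ] ℝ} (hΩ : Ω ≠ 0)
  {W : Dual ℝ V [⋀^Fin (n + 4)]→ₗ[ℝ] ℝ} (hW : W ≠ 0)
  {η : V →ₗ[ℝ] Dual ℝ V} {e e' : T →ₗ[ℝ] V} (hx : e' x = 0)
include hd c hΩ hW hx

/-- Only the entries `P₀ⱼ = ∑_ν B_jν η(ẽ Y_ν)` are nonzero, and `[τ, ẽ]` reduces to the contraction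
of the symmetric matrix `B` with the antisymmetric matrix `W(η(ẽ Y_ν), η(ẽ Y_j), …)`. -/
theorem starSum_mem_degeneracyFibre (hθx : ∀ ν, η (e' (Y ν)) (e x) = 0)
    {B : Matrix (Fin (n + 2)) (Fin (n + 2)) ℝ} (hB : B.IsSymm)
    (h_trace : (B * Matrix.of fun ν j => η (e' (Y ν)) (e (Y j))).trace = 0) :
    starSum Ω W x Y (fun ν => η (e' (Y ν))) B ∈ degeneracyFibre n η e e' := by
  let α (j : Fin (n + 2)) : Dual ℝ V := ∑ ν, B j ν • η (e' (Y ν))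
  let P : Fin (n + 3) → Fin (n + 3) → Dual ℝ V := vecCons (vecCons 0 α) 0
  have h_star : starSum Ω W x Y (fun ν => η (e' (Y ν))) B =
      ∑ a, ∑ b, starForm Ω W (d a) (d b) (P a b) := by
    rw [hd, sum_starForm_vecCons Ω W x Y P fun _ _ => rfl]
    simp [P, α, starSum_eq_sum]
  have h_zero (θ : Dual ℝ V) (ξ : Fin (n + 2) → Dual ℝ V) : W (vecCons θ (vecCons 0 ξ)) = 0 :=
    W.map_coord_zero (i := 1) rfl
  have h_zero' (ξ : Fin (n + 3) → Dual ℝ V) : W (vecCons 0 ξ) = 0 := W.map_coord_zero (i := 0) rfl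
  rw [h_star]
  refine ⟨(wedgePowMap_one_sum_starForm_eq_zero_iff Ω W d c hΩ hW e P).mpr fun a => ?_,
    (bracketMap_sum_starForm_eq_zero_iff Ω W η e' d hΩ P).mpr fun a ξ => ?_⟩ <;>
    refine Fin.cases ?_ (fun j => ?_) a <;> simp only [hd, Fin.sum_univ_succ (n := n + 2)]
  · simpa [P, α, Matrix.trace, Matrix.mul_apply] using h_trace
  · simp [P, α, hθx]
  · simp only [P, α, Matrix.cons_val_zero, Matrix.cons_val_succ, Pi.zero_apply, sub_zero, hx,
      map_zero, h_zero, zero_add, map_vecCons_sum]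
    refine sum_sum_eq_zero_of_antisymm _ _ fun a b => ?_
    rw [map_vecCons_swap, hB.apply, smul_neg]
  · simp [P, hx, h_zero, h_zero']

theorem exists_starSum_of_mem_degeneracyFibre
    (hθ : LinearIndependent ℝ fun ν => η (e' (Y ν)))
    {τ : BiForm T V (n + 1) (n + 3)} (hτ : τ ∈ degeneracyFibre n η e e') :
    ∃ B : Matrix (Fin (n + 2)) (Fin (n + 2)) ℝ, B.IsSymm ∧
      (B * Matrix.of fun ν j => η (e' (Y ν)) (e (Y j))).trace = 0 ∧
      τ = starSum Ω W x Y (fun ν => η (e' (Y ν))) B := by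
  obtain ⟨P, rfl⟩ := exists_eq_sum_starForm d c Ω hΩ W hW τ
  have h_wedge := (wedgePowMap_one_sum_starForm_eq_zero_iff Ω W d c hΩ hW e P).mp hτ.1
  have h_bracket := (bracketMap_sum_starForm_eq_zero_iff Ω W η e' d hΩ P).mp hτ.2
  have h_cartan (a : Fin (n + 3)) : ∃ B : Matrix (Fin (n + 2)) (Fin (n + 2)) ℝ, B.IsSymm ∧
      ∀ j : Fin (n + 2), P a j.succ - P j.succ a = ∑ ν, B j ν • η (e' (Y ν)) := by
    refine exists_isSymm_of_sum_smul_comm hθ fun φ => ?_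
    have h := sum_smul_comm_of_sum_map_vecCons_eq_zero c hW _ (fun b => P a b - P b a)
      (fun b => η (e' (d b))) (h_bracket a) φ
    simpa [Fin.sum_univ_succ, hd, hx] using h
  choose B hB_symm hB using h_cartan
  have hB_anti (i j ν : Fin (n + 2)) : B i.succ j ν = -B j.succ i ν := by
    have h : ∑ ν, (B i.succ j ν + B j.succ i ν) • η (e' (Y ν)) = 0 := by
      simp only [add_smul, Finset.sum_add_distrib, ← hB]
      abel
    exact eq_neg_of_add_eq_zero_left (Fintype.linearIndependent_iff.mp hθ _ h ν)
  have hB_zero (i j ν : Fin (n + 2)) : B i.succ j ν = 0 :=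
    eq_zero_of_antisymm_of_symm (fun i j ν => B i.succ j ν) hB_anti
      (fun i j ν => (hB_symm i.succ).apply ν j) i j ν
  have hP_symm (i j : Fin (n + 2)) : P i.succ j.succ = P j.succ i.succ :=
    sub_eq_zero.mp (by simp only [hB, hB_zero, zero_smul, Finset.sum_const_zero])
  refine ⟨B 0, hB_symm 0, ?_, ?_⟩
  · simpa [-LinearMap.sub_apply, Fin.sum_univ_succ (n := n + 2), hd, hB, Matrix.trace,
      Matrix.mul_apply] using h_wedge 0
  · rw [hd, sum_starForm_vecCons Ω W x Y P hP_symm]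
    simp only [hB]
    rfl

end DegeneracyFibre

section TriangularCompletion

open Matrix

variable {K ι : Type*} [Field K]

/-- The quadratic form of the matrix `g` vanishes only at `0`; over `ℝ`, this says that a symmetric
`g` is definite. -/
def IsAnisotropic [Fintype ι] (g : Matrix ι ι K) : Prop :=
  ∀ a : ι → K, a ⬝ᵥ g *ᵥ a = 0 → a = 0

theorem IsAnisotropic.isUnit_det [Fintype ι] [DecidableEq ι] {g : Matrix ι ι K}
    (hg : IsAnisotropic g) : IsUnit g.det := by
  rw [← isUnit_iff_isUnit_det, ← mulVec_injective_iff_isUnit, ← coe_mulVecLin,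
    injective_iff_map_eq_zero]
  exact fun a ha => hg a (by rw [← mulVecLin_apply, ha, dotProduct_zero])

theorem isSymm_mul_iff_exists_isSymm [Fintype ι] [DecidableEq ι] {g : Matrix ι ι K}
    (hg : g.IsSymm) (h_unit : IsUnit g.det) (A : Matrix ι ι K) :
    (g * A).IsSymm ↔ ∃ B : Matrix ι ι K, B.IsSymm ∧ A = B * g := by
  constructor
  · intro hA
    have hA' : Aᵀ * g = g * A := by simpa [hg.eq] using hA.eq
    refine ⟨A * g⁻¹, ?_, (nonsing_inv_mul_cancel_right _ _ h_unit).symm⟩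
    calc (A * g⁻¹)ᵀ = g⁻¹ * (Aᵀ * g) * g⁻¹ := by
          rw [transpose_mul, transpose_nonsing_inv, hg.eq, mul_assoc,
            mul_nonsing_inv_cancel_right _ _ h_unit]
      _ = A * g⁻¹ := by rw [hA', nonsing_inv_mul_cancel_left _ _ h_unit]
  · rintro ⟨B, hB, rfl⟩
    rw [IsSymm, transpose_mul, transpose_mul, hg.eq, hB.eq, mul_assoc]

/-- The columns of `L` vanish successively from the last one on: if all columns after the `j`-th one
are zero, then `(L * L) · j = 0`, hence `Lⱼᵀ g Lⱼ = (Lᵀ g L)ⱼⱼ = (g L L)ⱼⱼ = 0`. -/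
theorem eq_zero_of_strictlyLower_of_isSymm_mul [Fintype ι] [LinearOrder ι] {g L : Matrix ι ι K}
    (hg : g.IsSymm) (h_aniso : IsAnisotropic g) (hL : ∀ i j, i ≤ j → L i j = 0)
    (hgL : (g * L).IsSymm) : L = 0 := by
  have h_comm : Lᵀ * g = g * L := by simpa [hg.eq] using hgL.eq
  suffices h_col : ∀ j i, L i j = 0 from Matrix.ext fun i j => h_col j i
  intro j
  induction j using WellFoundedGT.induction with
  | ind j ih =>
    have h_sq (i : ι) : (L * L) i j = 0 := by
      rw [Matrix.mul_apply]
      refine Finset.sum_eq_zero fun k _ => ?_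
      rcases le_or_gt k j with hkj | hkj
      · rw [hL k j hkj, mul_zero]
      · rw [ih k hkj, zero_mul]
    refine congrFun (h_aniso (fun i => L i j) ?_)
    calc (fun i => L i j) ⬝ᵥ g *ᵥ (fun i => L i j) = (Lᵀ * (g * L)) j j := rfl
      _ = (g * (L * L)) j j := by rw [← mul_assoc, h_comm, mul_assoc]
      _ = 0 := by
        rw [Matrix.mul_apply]
        simp only [h_sq, mul_zero, Finset.sum_const_zero]

variable (K ι) in
/-- The matrix with zeros on and above the diagonal and the entries `x ⟨(j, i), _⟩` at `(i, j)`. -/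
def strictlyLower [LinearOrder ι] : ({p : ι × ι // p.1 < p.2} → K) →ₗ[K] Matrix ι ι K where
  toFun x := Matrix.of fun i j => if h : j < i then x ⟨(j, i), h⟩ else 0
  map_add' x y := by ext i j; by_cases h : j < i <;> simp [h]
  map_smul' r x := by ext i j; by_cases h : j < i <;> simp [h]

variable (K ι) in
/-- The entries `Zᵢⱼ - Zⱼᵢ`, `i < j`, of the skew part of a matrix. -/
def skewEntries [LinearOrder ι] : Matrix ι ι K →ₗ[K] ({p : ι × ι // p.1 < p.2} → K) :=
  LinearMap.pi fun p => entryLinearMap K K p.1.1 p.1.2 - entryLinearMap K K p.1.2 p.1.1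

variable [LinearOrder ι]

theorem strictlyLower_apply_of_le (x : {p : ι × ι // p.1 < p.2} → K) {i j : ι} (h : i ≤ j) :
    strictlyLower K ι x i j = 0 :=
  dif_neg h.not_gt

theorem strictlyLower_apply_of_lt (x : {p : ι × ι // p.1 < p.2} → K) {i j : ι} (h : j < i) :
    strictlyLower K ι x i j = x ⟨(j, i), h⟩ :=
  dif_pos h

theorem strictlyLower_add_diagonal_add_transpose (Z : Matrix ι ι K) :
    strictlyLower K ι (fun p => Z p.1.2 p.1.1) +
      (diagonal (fun i => Z i i) + (strictlyLower K ι fun p => Z p.1.1 p.1.2)ᵀ) = Z := by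
  ext i j
  rcases lt_trichotomy i j with h | rfl | h
  · simp [strictlyLower_apply_of_le _ h.le, strictlyLower_apply_of_lt _ h, h.ne]
  · simp [strictlyLower_apply_of_le]
  · simp [strictlyLower_apply_of_le _ h.le, strictlyLower_apply_of_lt _ h, h.ne']

theorem skewEntries_eq_zero_iff (Z : Matrix ι ι K) : skewEntries K ι Z = 0 ↔ Z.IsSymm := by
  simp only [funext_iff, Subtype.forall, Prod.forall, IsSymm.ext_iff]
  constructor
  · intro h i j
    rcases lt_trichotomy i j with hij | rfl | hij
    · exact (sub_eq_zero.mp (h i j hij)).symm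
    · rfl
    · exact sub_eq_zero.mp (h j i hij)
  · exact fun h i j _ => sub_eq_zero.mpr (h j i)

variable [Fintype ι]

theorem exists_isSymm_mul_iff_lower_eq {g : Matrix ι ι K} (hg : g.IsSymm)
    (h_aniso : IsAnisotropic g) :
    ∃ f : (({p : ι × ι // p.1 < p.2} → K) × (ι → K)) →ₗ[K] ({p : ι × ι // p.1 < p.2} → K),
      ∀ Z : Matrix ι ι K, (g * Z).IsSymm ↔
        (fun p => Z p.1.2 p.1.1) = f (fun p => Z p.1.1 p.1.2, fun i => Z i i) := by
  let skew := skewEntries K ι ∘ₗ mulLeftLinearMap ι K g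
  have h_skew (Z : Matrix ι ι K) : skew Z = 0 ↔ (g * Z).IsSymm := skewEntries_eq_zero_iff _
  have h_inj : Function.Injective (skew ∘ₗ strictlyLower K ι) := by
    refine (injective_iff_map_eq_zero _).mpr fun x hx => funext fun ⟨p, hp⟩ => ?_
    have h := eq_zero_of_strictlyLower_of_isSymm_mul hg h_aniso
      (fun i j => strictlyLower_apply_of_le x) ((h_skew _).mp hx)
    rw [← strictlyLower_apply_of_lt x hp, h]
    rfl
  let Φ := LinearEquiv.ofInjectiveEndo (skew ∘ₗ strictlyLower K ι) h_inj
  let upper : (({p : ι × ι // p.1 < p.2} → K) × (ι → K)) →ₗ[K] Matrix ι ι K :=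
    diagonalLinearMap ι K K ∘ₗ LinearMap.snd K _ _ +
      (transposeLinearEquiv ι ι K K).toLinearMap ∘ₗ strictlyLower K ι ∘ₗ LinearMap.fst K _ _
  refine ⟨-(Φ.symm.toLinearMap ∘ₗ skew ∘ₗ upper), fun Z => ?_⟩
  have h_split : skew Z = Φ (fun p => Z p.1.2 p.1.1) +
      skew (upper (fun p => Z p.1.1 p.1.2, fun i => Z i i)) := by
    conv_lhs => rw [← strictlyLower_add_diagonal_add_transpose Z, map_add]
    rfl
  rw [← h_skew, h_split, add_eq_zero_iff_eq_neg, ← LinearEquiv.eq_symm_apply, map_neg]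
  rfl

theorem exists_triangular_completion {g : Matrix ι ι K} (hg : g.IsSymm)
    (h_aniso : IsAnisotropic g) :
    ∃ f : ι → ι → ((({p : ι × ι // p.1 < p.2} → K) × (ι → K)) →ₗ[K] K),
      ∀ Z : Matrix ι ι K, (g * Z).IsSymm ↔
        ∀ i j, i < j → Z j i = f i j (fun p => Z p.1.1 p.1.2, fun i => Z i i) := by
  obtain ⟨f, hf⟩ := exists_isSymm_mul_iff_lower_eq hg h_aniso
  refine ⟨fun i j => if h : i < j then LinearMap.proj ⟨(i, j), h⟩ ∘ₗ f else 0, fun Z => ?_⟩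
  simp only [hf, funext_iff, Subtype.forall, Prod.forall]
  refine forall₃_congr fun i j h => ?_
  rw [dif_pos h]
  rfl

end TriangularCompletion

section Lorentzian

variable {T V : Type*} [AddCommGroup T] [Module ℝ T] [AddCommGroup V] [Module ℝ V]

/-- The family `b` is orthonormal for `η`, with signs `(+, …, +, -)`. -/
def IsLorentzOrthonormal {m : ℕ} (η : V →ₗ[ℝ] Dual ℝ V) (b : Fin (m + 1) → V) : Prop :=
  ∀ i j, η (b i) (b j) = if i = j then (if i = Fin.last m then -1 else 1) else 0

/-- A bilinear form of signature `(m, 1)`: it has an orthonormal basis. -/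
def IsLorentzian (m : ℕ) (η : V →ₗ[ℝ] Dual ℝ V) : Prop :=
  ∃ b : Basis (Fin (m + 1)) ℝ V, IsLorentzOrthonormal η b

section Orthonormal

variable {m : ℕ} {η : V →ₗ[ℝ] Dual ℝ V} {b : Basis (Fin (m + 1)) ℝ V}

theorem IsLorentzOrthonormal.apply_eq (hb : IsLorentzOrthonormal η b) (v w : V) :
    η v w = ∑ i : Fin m, b.repr v i.castSucc * b.repr w i.castSucc -
      b.repr v (Fin.last m) * b.repr w (Fin.last m) := by
  conv_lhs => rw [← b.sum_repr v, ← b.sum_repr w]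
  simp only [map_sum, map_smul, LinearMap.sum_apply, LinearMap.smul_apply, hb _ _, smul_eq_mul]
  rw [Fin.sum_univ_castSucc]
  simp [Fin.castSucc_ne_last, sub_eq_add_neg, mul_comm]

theorem IsLorentzOrthonormal.eq_zero_of_spacelike_of_null (hb : IsLorentzOrthonormal η b) {u : V}
    (h_time : b.repr u (Fin.last m) = 0) (hu : η u u = 0) : u = 0 := by
  rw [hb.apply_eq, h_time, mul_zero, sub_zero,
    Finset.sum_eq_zero_iff_of_nonneg fun i _ => mul_self_nonneg _] at hu
  refine b.ext_elem fun i => ?_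
  rcases Fin.eq_castSucc_or_eq_last i with ⟨i, rfl⟩ | rfl
  · simpa using hu i (Finset.mem_univ i)
  · simpa using h_time

end Orthonormal

namespace IsLorentzian

variable {m : ℕ} {η : V →ₗ[ℝ] Dual ℝ V} (h : IsLorentzian m η)
include h

theorem symm (v w : V) : η v w = η w v := by
  obtain ⟨b, hb⟩ := h
  simp only [hb.apply_eq, mul_comm]

theorem nondegenerate {v : V} (hv : ∀ w, η v w = 0) : v = 0 := by
  obtain ⟨b, hb⟩ := h
  refine b.ext_elem fun i => ?_
  have := hv (b i)
  rw [hb.apply_eq] at this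
  rcases Fin.eq_castSucc_or_eq_last i with ⟨i, rfl⟩ | rfl <;>
    simpa [Finsupp.single_apply, (Fin.castSucc_ne_last _).symm, Fin.castSucc_ne_last] using this

theorem finrank_eq : finrank ℝ V = m + 1 := by
  obtain ⟨b, -⟩ := h
  rw [finrank_eq_card_basis b, Fintype.card_fin]

theorem exists_dualBasis_metric {v : Fin m → V} (hv : LinearIndependent ℝ v) :
    ∃ (k : V) (c : Basis (Fin (m + 1)) ℝ (Dual ℝ V)),
      ⇑c = Matrix.vecCons (η k) fun i => η (v i) := by
  have : Module.Finite ℝ V := Module.finite_of_finrank_pos (h.finrank_eq ▸ m.succ_pos)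
  have h_inj : Function.Injective η := (injective_iff_map_eq_zero η).mpr fun v hv =>
    h.nondegenerate fun w => by rw [hv, LinearMap.zero_apply]
  obtain ⟨k, hk⟩ := exists_linearIndependent_cons_of_lt_finrank hv (h.finrank_eq ▸ m.lt_succ_self)
  refine ⟨k, basisOfLinearIndependentOfCardEqFinrank (hk.map_injOn η h_inj.injOn) ?_, ?_⟩
  · rw [Subspace.dual_finrank_eq, h.finrank_eq, Fintype.card_fin]
  · rw [coe_basisOfLinearIndependentOfCardEqFinrank]
    exact Fin.comp_cons η k v

/-- Two orthogonal null vectors `v`, `w` with time components `t`, `s` have a spacelike null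
combination `t w - s v`, which must vanish. -/
theorem exists_smul_of_orthogonal_null {v w : V} (hv : η v v = 0) (hv0 : v ≠ 0) (hvw : η v w = 0)
    (hw : η w w = 0) : ∃ r : ℝ, w = r • v := by
  have hwv : η w v = 0 := (h.symm w v).trans hvw
  obtain ⟨b, hb⟩ := h
  let t := b.repr v (Fin.last m)
  let s := b.repr w (Fin.last m)
  have ht : t ≠ 0 := fun ht => hv0 (hb.eq_zero_of_spacelike_of_null ht hv)
  have h_comb : t • w - s • v = 0 := by
    refine hb.eq_zero_of_spacelike_of_null ?_ (by simp [hv, hw, hvw, hwv])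
    simp [t, s, mul_comm]
  exact ⟨t⁻¹ * s, by rw [mul_smul, ← sub_eq_zero.mp h_comb, inv_smul_smul₀ ht]⟩

end IsLorentzian

end Lorentzian

section Components

open Matrix (vecCons)

theorem exists_eq_comp_perm {ι β : Type*} [Finite ι] {g I : ι → β} (hI : Function.Injective I)
    (h : ∀ k, ∃ l, g l = I k) : ∃ σ : Equiv.Perm ι, I = g ∘ σ := by
  choose s hs using h
  have hs_inj : Function.Injective s := fun k l hkl => hI (by rw [← hs, ← hs, hkl])
  exact ⟨Equiv.ofBijective s (Finite.injective_iff_bijective.mp hs_inj),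
    funext fun k => (hs k).symm⟩

section Indices

variable {n : ℕ} (μ ν : Fin (n + 2))

theorem exists_lowerIndices_eq {i : Fin (n + 3)} (h_last : i ≠ Fin.last (n + 2))
    (hν : i ≠ ν.castSucc) : ∃ l, lowerIndices ν l = i := by
  obtain ⟨i, rfl⟩ := Fin.exists_castSucc_eq.mpr h_last
  obtain ⟨l, rfl⟩ := Fin.exists_succAbove_eq (x := i) (y := ν) fun hi => hν (by rw [hi])
  exact ⟨l, rfl⟩

theorem exists_upperIndices_eq {i : Fin (n + 4)} (hμ : i ≠ μ.castSucc.castSucc) :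
    ∃ l, upperIndices μ ν l = i := by
  rcases Fin.eq_castSucc_or_eq_last i with ⟨i, rfl⟩ | rfl
  · rcases Fin.eq_castSucc_or_eq_last i with ⟨i, rfl⟩ | rfl
    · have hi : Equiv.swap μ ν i ≠ ν := fun hi => hμ (by
        rw [Equiv.swap_apply_eq_iff, Equiv.swap_apply_right] at hi
        rw [hi])
      obtain ⟨l, hl⟩ := Fin.exists_succAbove_eq hi
      exact ⟨l.succ.succ, by simp [upperIndices, hl]⟩
    · exact ⟨1, rfl⟩
  · exact ⟨0, rfl⟩

theorem comp_upperIndices {β : Type*} (c : Fin (n + 4) → β) :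
    (fun k => c (upperIndices μ ν k)) =
      vecCons (c (Fin.last (n + 3))) (vecCons (c (Fin.last (n + 2)).castSucc)
        (ν.removeNth ((fun a => c a.castSucc.castSucc) ∘ Equiv.swap μ ν))) := by
  funext k
  exact Fin.cases rfl (fun k => Fin.cases rfl (fun _ => rfl) k) k

end Indices

section Values

variable {R T N : Type*} [CommRing R] [AddCommGroup T] [Module R T] [AddCommGroup N] [Module R N]

theorem injective_of_map_vecCons_ne_zero {k : ℕ} {ι : Type*} (f : T [⋀^Fin (k + 1)]→ₗ[R] N)
    {d : ι → T} {x : T} {I : Fin k → ι} (h : f (vecCons x fun l => d (I l)) ≠ 0) :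
    Function.Injective I ∧ ∀ l, d (I l) ≠ x := by
  refine ⟨fun l l' hl => ?_, fun l hl => ?_⟩
  · by_contra hne
    exact h (f.map_eq_zero_of_eq _ (i := l.succ) (j := l'.succ) (by simp [hl])
      fun h => hne (Fin.succ_injective _ h))
  · exact h (f.map_eq_zero_of_eq _ (i := 0) (j := l.succ) (by simp [hl]) (Fin.succ_ne_zero _).symm)

variable {n : ℕ}

theorem map_vecCons_lowerIndices (Ω : T [⋀^Fin (n + 3)]→ₗ[R] N) (d : Fin (n + 3) → T)
    (j ν : Fin (n + 2)) :
    Ω (vecCons (d (Fin.last (n + 2))) (vecCons (d j.castSucc) fun k => d (lowerIndices ν k))) =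
      if j = ν then
        (-1 : R) ^ (ν : ℕ) • Ω (vecCons (d (Fin.last (n + 2))) fun i => d i.castSucc)
      else 0 :=
  map_vecCons_removeNth (Ω.curryLeft (d (Fin.last (n + 2)))) ν j fun i => d i.castSucc

theorem map_vecCons_upperIndices (W : T [⋀^Fin (n + 4)]→ₗ[R] N) (c : Fin (n + 4) → T)
    (a μ ν : Fin (n + 2)) :
    W (vecCons (c a.castSucc.castSucc) fun k => c (upperIndices μ ν k)) =
      if a = μ then
        (-1 : R) ^ (ν : ℕ) • Equiv.Perm.sign (Equiv.swap μ ν) •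
          W (vecCons (c (Fin.last (n + 3))) (vecCons (c (Fin.last (n + 2)).castSucc)
            fun i : Fin (n + 2) => c i.castSucc.castSucc))
      else 0 := by
  let f := (W.curryLeft (c (Fin.last (n + 3)))).curryLeft (c (Fin.last (n + 2)).castSucc)
  let C : Fin (n + 2) → T := fun i => c i.castSucc.castSucc
  calc W (vecCons (c a.castSucc.castSucc) fun k => c (upperIndices μ ν k))
      = f (vecCons (C a) (ν.removeNth (C ∘ Equiv.swap μ ν))) := by
        rw [comp_upperIndices, map_vecCons_swap]
        exact neg_eq_iff_eq_neg.mpr (map_vecCons_swap (W.curryLeft (c (Fin.last (n + 3)))) _ _ _)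
    _ = if Equiv.swap μ ν a = ν then (-1 : R) ^ (ν : ℕ) • f (C ∘ Equiv.swap μ ν) else 0 := by
        simpa using map_vecCons_removeNth f ν (Equiv.swap μ ν a) (C ∘ Equiv.swap μ ν)
    _ = _ := by
        simp only [Equiv.swap_apply_eq_iff, Equiv.swap_apply_right, f.map_perm]
        rfl

end Values

variable {T V : Type*} [AddCommGroup T] [Module ℝ T] [AddCommGroup V] [Module ℝ V]

theorem biForm_ext_component {i j m k : ℕ} (d : Basis (Fin m) ℝ T) (b : Basis (Fin k) ℝ V)
    {τ τ' : BiForm T V i j} (h : ∀ I J, component d b τ I J = component d b τ' I J) : τ = τ' := by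
  refine Basis.ext_alternating d fun I _ => Basis.ext_alternating b.dualBasis fun J _ => ?_
  simpa [component] using h I J

theorem component_perm {i j : ℕ} {ι κ : Type*} (d : ι → T) (b : Basis κ ℝ V) (τ : BiForm T V i j)
    (I : Fin i → ι) (J : Fin j → κ) (σ : Equiv.Perm (Fin i)) (ρ : Equiv.Perm (Fin j)) :
    component d b τ (I ∘ σ) (J ∘ ρ) =
      Equiv.Perm.sign σ • Equiv.Perm.sign ρ • component d b τ I J := by
  change τ ((fun k => d (I k)) ∘ σ) ((fun k => b.coord (J k)) ∘ ρ) = _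
  rw [AlternatingMap.map_perm, AlternatingMap.map_perm]
  exact smul_comm _ _ _

variable {n : ℕ} (d : Fin (n + 3) → T) (b : Basis (Fin (n + 4)) ℝ V)
  (Ω : T [⋀^Fin (n + 3)]→ₗ[ℝ] ℝ) (W : Dual ℝ V [⋀^Fin (n + 4)]→ₗ[ℝ] ℝ)

/-- The form whose only components are, up to sign and a common factor, `X_μ^ν = A_νμ` and
`Y_ν = A_νν`. -/
noncomputable def coordStarSum (A : Matrix (Fin (n + 2)) (Fin (n + 2)) ℝ) :
    BiForm T V (n + 1) (n + 3) :=
  starSum Ω W (d (Fin.last (n + 2))) (fun j => d j.castSucc)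
    (fun a => b.coord a.castSucc.castSucc) A

/-- The common factor of the components `X` and `Y` of `coordStarSum`. -/
noncomputable def coordStarFactor : ℝ :=
  Ω (vecCons (d (Fin.last (n + 2))) fun j => d j.castSucc) *
    W (vecCons (b.coord (Fin.last (n + 3))) (vecCons (b.coord (Fin.last (n + 2)).castSucc)
      fun a : Fin (n + 2) => b.coord a.castSucc.castSucc))

variable (A : Matrix (Fin (n + 2)) (Fin (n + 2)) ℝ)

theorem component_coordStarSum (I : Fin (n + 1) → Fin (n + 3)) (J : Fin (n + 3) → Fin (n + 4)) :
    component d b (coordStarSum d b Ω W A) I J =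
      ∑ j : Fin (n + 2), ∑ a : Fin (n + 2), A j a *
        (Ω (vecCons (d (Fin.last (n + 2))) (vecCons (d j.castSucc) fun k => d (I k))) *
          W (vecCons (b.coord a.castSucc.castSucc) fun k => b.coord (J k))) :=
  starSum_apply ..

theorem component_coordStarSum_lower_upper (μ ν : Fin (n + 2)) :
    component d b (coordStarSum d b Ω W A) (lowerIndices ν) (upperIndices μ ν) =
      Equiv.Perm.sign (Equiv.swap μ ν) • (coordStarFactor d b Ω W * A ν μ) := by
  have h_sq : ((-1 : ℝ) ^ (ν : ℕ)) * (-1) ^ (ν : ℕ) = 1 := by rw [← mul_pow]; simp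
  simp only [component_coordStarSum, map_vecCons_lowerIndices, map_vecCons_upperIndices W b.coord,
    ite_mul, mul_ite, zero_mul, mul_zero, Finset.sum_ite_eq', Finset.mem_univ, if_true, smul_eq_mul]
  rw [mul_smul_comm, mul_smul_comm, mul_smul_comm, mul_mul_mul_comm, h_sq, one_mul, mul_comm,
    coordStarFactor]

theorem compY_coordStarSum (ν : Fin (n + 2)) :
    compY d b (coordStarSum d b Ω W A) ν = coordStarFactor d b Ω W * A ν ν := by
  rw [compY, component_coordStarSum_lower_upper]
  simp

theorem compX_coordStarSum {μ ν : Fin (n + 2)} (h : μ ≠ ν) :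
    compX d b (coordStarSum d b Ω W A) μ ν = -(coordStarFactor d b Ω W * A ν μ) := by
  rw [compX, component_coordStarSum_lower_upper, Equiv.Perm.sign_swap h]
  simp

theorem isXYIndex_of_component_coordStarSum_ne_zero {I : Fin (n + 1) → Fin (n + 3)}
    {J : Fin (n + 3) → Fin (n + 4)} (h : component d b (coordStarSum d b Ω W A) I J ≠ 0) :
    IsXYIndex I J := by
  rw [component_coordStarSum] at h
  obtain ⟨ν, -, h⟩ := Finset.exists_ne_zero_of_sum_ne_zero h
  obtain ⟨μ, -, h⟩ := Finset.exists_ne_zero_of_sum_ne_zero h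
  have hΩ := left_ne_zero_of_mul (right_ne_zero_of_mul h)
  have hW := right_ne_zero_of_mul (right_ne_zero_of_mul h)
  obtain ⟨hI, hIν⟩ := injective_of_map_vecCons_ne_zero (Ω.curryLeft (d (Fin.last (n + 2)))) hΩ
  rw [map_vecCons_swap, neg_ne_zero] at hΩ
  obtain ⟨-, hI_last⟩ := injective_of_map_vecCons_ne_zero (Ω.curryLeft (d ν.castSucc)) hΩ
  obtain ⟨hJ, hJμ⟩ := injective_of_map_vecCons_ne_zero W (d := b.coord) hW
  obtain ⟨σ, hσ⟩ := exists_eq_comp_perm hI fun k => exists_lowerIndices_eq ν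
    (fun h => hI_last k (by rw [h])) (fun h => hIν k (by rw [h]))
  obtain ⟨ρ, hρ⟩ := exists_eq_comp_perm hJ fun k => exists_upperIndices_eq μ ν
    (fun h => hJμ k (by rw [h]))
  exact ⟨μ, ν, σ, ρ, hσ, hρ⟩

theorem exists_eq_coordStarSum (d : Basis (Fin (n + 3)) ℝ T) (hκ : coordStarFactor d b Ω W ≠ 0)
    {τ : BiForm T V (n + 1) (n + 3)} (hτ : ∀ I J, component d b τ I J ≠ 0 → IsXYIndex I J) :
    ∃ A, τ = coordStarSum d b Ω W A := by
  let A : Matrix (Fin (n + 2)) (Fin (n + 2)) ℝ := Matrix.of fun ν μ =>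
    (coordStarFactor d b Ω W)⁻¹ * Equiv.Perm.sign (Equiv.swap μ ν) •
      component d b τ (lowerIndices ν) (upperIndices μ ν)
  refine ⟨A, biForm_ext_component d b fun I J => ?_⟩
  by_cases h : IsXYIndex I J
  · obtain ⟨μ, ν, σ, ρ, rfl, rfl⟩ := h
    rw [component_perm, component_perm, component_coordStarSum_lower_upper]
    simp only [A, Matrix.of_apply]
    rw [mul_inv_cancel_left₀ hκ, smul_smul (Equiv.Perm.sign (Equiv.swap μ ν)), Int.units_mul_self,
      one_smul]
  · rw [not_ne_iff.mp (mt (hτ I J) h),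
      not_ne_iff.mp (mt (isXYIndex_of_component_coordStarSum_ne_zero d b Ω W A) h)]

end Components

section LightLike

open Matrix (vecCons)
open scoped Matrix

variable {T V : Type*} [AddCommGroup T] [Module ℝ T] [AddCommGroup V] [Module ℝ V]

/-- A point of a light-like boundary: the metric `η` has signature `(m, 1)`, and the nonzero vector
`x` spans the kernel of the degenerate metric `η(e, e)`. -/
structure IsLightLike (m : ℕ) (η : V →ₗ[ℝ] Dual ℝ V) (e : T →ₗ[ℝ] V) (x : T) : Prop where
  lorentzian : IsLorentzian m η
  injective : Function.Injective e
  ne_zero : x ≠ 0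
  null (u : T) : η (e x) (e u) = 0

/-- The coframe `ẽ = e - β ⊗ e x`, which has `x` in its kernel if `β x = 1`. -/
def transverseCoframe (e : T →ₗ[ℝ] V) (β : Dual ℝ T) (x : T) : T →ₗ[ℝ] V :=
  e - β.smulRight (e x)

/-- The Gram matrix of vectors `Y` for the metric `η(e, e)`. -/
def gram {ι : Type*} (η : V →ₗ[ℝ] Dual ℝ V) (e : T →ₗ[ℝ] V) (Y : ι → T) : Matrix ι ι ℝ :=
  Matrix.of fun i j => η (e (Y i)) (e (Y j))

theorem dotProduct_gram_mulVec {ι : Type*} [Fintype ι] (η : V →ₗ[ℝ] Dual ℝ V) (e : T →ₗ[ℝ] V)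
    (Y : ι → T) (a : ι → ℝ) :
    a ⬝ᵥ gram η e Y *ᵥ a = η (e (∑ i, a i • Y i)) (e (∑ i, a i • Y i)) := by
  conv_rhs => rw [map_sum e, map_sum η, LinearMap.sum_apply]
  simp [gram, dotProduct, Matrix.mulVec, mul_comm, Finset.mul_sum, mul_left_comm]

section TransverseCoframe

variable (e : T →ₗ[ℝ] V) (β : Dual ℝ T) (x u : T)

theorem transverseCoframe_apply : transverseCoframe e β x u = e u - β u • e x := rfl

variable {β x} in
theorem transverseCoframe_apply_self (hβ : β x = 1) : transverseCoframe e β x x = 0 := by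
  rw [transverseCoframe_apply, hβ, one_smul, sub_self]

end TransverseCoframe

namespace IsLightLike

variable {m : ℕ} {η : V →ₗ[ℝ] Dual ℝ V} {e : T →ₗ[ℝ] V} {x : T} (h : IsLightLike m η e x)
include h

theorem exists_smul_of_null {u : T} (hu : η (e u) (e u) = 0) : ∃ r : ℝ, u = r • x := by
  obtain ⟨r, hr⟩ := h.lorentzian.exists_smul_of_orthogonal_null (h.null x)
    ((map_ne_zero_iff e h.injective).mpr h.ne_zero) (h.null u) hu
  exact ⟨r, h.injective (by rw [hr, map_smul])⟩

theorem of_null {y : T} (hy0 : y ≠ 0) (hy : ∀ u, η (e y) (e u) = 0) : IsLightLike m η e y :=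
  ⟨h.lorentzian, h.injective, hy0, hy⟩

theorem exists_transverseCoframe_eq {β : Dual ℝ T} (hβ : β x = 1) {y : T} (hy0 : y ≠ 0)
    (hy : ∀ u, η (e y) (e u) = 0) :
    ∃ γ : Dual ℝ T, γ y = 1 ∧ transverseCoframe e γ y = transverseCoframe e β x := by
  obtain ⟨r, rfl⟩ := h.exists_smul_of_null (hy y)
  have hr : r ≠ 0 := left_ne_zero_of_smul hy0
  refine ⟨r⁻¹ • β, by simp [hβ, hr], LinearMap.ext fun u => ?_⟩
  simp [transverseCoframe_apply, smul_smul, hr, mul_right_comm]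

section Gram

variable {k : ℕ} {Y : Fin k → T}

theorem gram_isSymm : (gram η e Y).IsSymm :=
  Matrix.ext fun _ _ => h.lorentzian.symm _ _

theorem gram_isAnisotropic (hY : LinearIndependent ℝ (vecCons x Y)) :
    IsAnisotropic (gram η e Y) := by
  intro a ha
  rw [dotProduct_gram_mulVec] at ha
  obtain ⟨r, hr⟩ := h.exists_smul_of_null ha
  funext i
  exact Fintype.linearIndependent_iff.mp hY (vecCons (-r) a)
    (by simp [Fin.sum_univ_succ, hr]) i.succ

end Gram

section Metric

variable (β : Dual ℝ T)

theorem metric_transverseCoframe_left (u v : T) :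
    η (transverseCoframe e β x u) (e v) = η (e u) (e v) := by
  simp [transverseCoframe_apply, h.null]

theorem metric_transverseCoframe (u v : T) :
    η (transverseCoframe e β x u) (transverseCoframe e β x v) = η (e u) (e v) := by
  rw [transverseCoframe_apply e β x v, map_sub, map_smul, h.metric_transverseCoframe_left,
    h.metric_transverseCoframe_left, h.lorentzian.symm (e u) (e x), h.null, smul_zero, sub_zero]

theorem linearIndependent_metric {k : ℕ} {Y : Fin k → T}
    (hY : LinearIndependent ℝ (vecCons x Y)) :
    LinearIndependent ℝ fun ν => η (transverseCoframe e β x (Y ν)) := by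
  refine Fintype.linearIndependent_iff.mpr fun a ha => congrFun (h.gram_isAnisotropic hY a ?_)
  have h_vecMul : a ᵥ* gram η e Y = 0 := by
    funext j
    simpa [LinearMap.sum_apply, h.metric_transverseCoframe_left, gram, Matrix.vecMul, dotProduct]
      using LinearMap.congr_fun ha (e (Y j))
  rw [Matrix.dotProduct_mulVec, h_vecMul, zero_dotProduct]

end Metric

variable {β : Dual ℝ T} (hβ : β x = 1)
include hβ

theorem mem_degeneracyFibre_iff {n : ℕ} {Y : Fin (n + 2) → T}
    {d : Basis (Fin (n + 3)) ℝ T} (hd : ⇑d = vecCons x Y) (c : Basis (Fin (n + 4)) ℝ (Dual ℝ V))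
    {Ω : T [⋀^Fin (n + 3)]→ₗ[ℝ] ℝ} (hΩ : Ω ≠ 0) {W : Dual ℝ V [⋀^Fin (n + 4)]→ₗ[ℝ] ℝ}
    (hW : W ≠ 0) {τ : BiForm T V (n + 1) (n + 3)} :
    τ ∈ degeneracyFibre n η e (transverseCoframe e β x) ↔
      ∃ B : Matrix (Fin (n + 2)) (Fin (n + 2)) ℝ, B.IsSymm ∧ (B * gram η e Y).trace = 0 ∧
        τ = starSum Ω W x Y (fun ν => η (transverseCoframe e β x (Y ν))) B := by
  have hx := transverseCoframe_apply_self e hβ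
  have h_gram : (Matrix.of fun ν j => η (transverseCoframe e β x (Y ν)) (e (Y j))) =
      gram η e Y := Matrix.ext fun _ _ => h.metric_transverseCoframe_left β _ _
  rw [← h_gram]
  constructor
  · exact exists_starSum_of_mem_degeneracyFibre hd c hΩ hW hx
      (h.linearIndependent_metric β (hd ▸ d.linearIndependent))
  · rintro ⟨B, hB, h_trace, rfl⟩
    refine starSum_mem_degeneracyFibre hd c hΩ hW hx (fun ν => ?_) hB h_trace
    rw [h.metric_transverseCoframe_left, h.lorentzian.symm, h.null]

end IsLightLike

end LightLike

section ComponentDescription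

open Matrix (vecCons)

theorem coe_reindex_finRotate {R M : Type*} [Ring R] [AddCommGroup M] [Module R M] {m : ℕ}
    (d : Basis (Fin (m + 1)) R M) :
    ⇑(d.reindex (finRotate (m + 1))) = vecCons (d (Fin.last m)) fun i => d i.castSucc := by
  rw [Basis.coe_reindex]
  funext i
  obtain ⟨i, rfl⟩ := (finRotate (m + 1)).surjective i
  rw [Function.comp_apply, Equiv.symm_apply_apply]
  rcases Fin.eq_castSucc_or_eq_last i with ⟨i, rfl⟩ | rfl
  · rw [finRotate_apply, Fin.coeSucc_eq_succ]
    rfl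
  · rw [finRotate_last]
    rfl

variable {T V : Type*} [AddCommGroup T] [Module ℝ T] [AddCommGroup V] [Module ℝ V] {n : ℕ}

theorem coordStarFactor_ne_zero (d : Basis (Fin (n + 3)) ℝ T) (b : Basis (Fin (n + 4)) ℝ V)
    {Ω : T [⋀^Fin (n + 3)]→ₗ[ℝ] ℝ} (hΩ : Ω ≠ 0) {W : Dual ℝ V [⋀^Fin (n + 4)]→ₗ[ℝ] ℝ}
    (hW : W ≠ 0) : coordStarFactor d b Ω W ≠ 0 := by
  let c := b.dualBasis.reindex (finRotate (n + 4))
  have hc : ⇑(c.reindex (finRotate (n + 4))) =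
      vecCons (b.coord (Fin.last (n + 2)).castSucc) (vecCons (b.coord (Fin.last (n + 3)))
        fun a : Fin (n + 2) => b.coord a.castSucc.castSucc) := by
    rw [coe_reindex_finRotate, coe_reindex_finRotate, b.coe_dualBasis]
    congr 1
    funext i
    exact Fin.cases rfl (fun _ => rfl) i
  refine mul_ne_zero ?_ ?_
  · rw [← coe_reindex_finRotate]
    exact (Ω.map_basis_ne_zero_iff _).mpr hΩ
  · rw [map_vecCons_swap, neg_ne_zero, ← hc]
    exact (W.map_basis_ne_zero_iff _).mpr hW

theorem starSum_sum_smul {ι : Type*} [Fintype ι] {i j : ℕ} (Ω : T [⋀^Fin (i + 2)]→ₗ[ℝ] ℝ)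
    (W : Dual ℝ V [⋀^Fin (j + 1)]→ₗ[ℝ] ℝ) (x : T) (Y : ι → T) (θ : ι → Dual ℝ V)
    (B G : Matrix ι ι ℝ) :
    starSum Ω W x Y (fun ν => ∑ a, G ν a • θ a) B = starSum Ω W x Y θ (B * G) := by
  simp only [starSum_eq_sum, Matrix.mul_apply, Finset.smul_sum, Finset.sum_smul, smul_smul]
  exact Finset.sum_congr rfl fun a _ => by rw [Finset.sum_comm]

namespace IsLightLike

variable {m : ℕ} {η : V →ₗ[ℝ] Dual ℝ V} {e : T →ₗ[ℝ] V} {β : Dual ℝ T}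
  {d : Basis (Fin (n + 3)) ℝ T} (h : IsLightLike m η e (d (Fin.last (n + 2))))
  {b : Basis (Fin (n + 4)) ℝ V} (hb : ∀ i, b i.castSucc = e (d i))
  (hb_last : ∀ u, η (b (Fin.last (n + 3))) (transverseCoframe e β (d (Fin.last (n + 2))) u) = 0)
include h hb hb_last

theorem metric_transverseCoframe_eq_sum_coord (ν : Fin (n + 2)) :
    η (transverseCoframe e β (d (Fin.last (n + 2))) (d ν.castSucc)) =
      ∑ a : Fin (n + 2), gram η e (fun j : Fin (n + 2) => d j.castSucc) ν a •
        b.coord a.castSucc.castSucc := by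
  refine b.ext fun i => ?_
  simp only [LinearMap.sum_apply, LinearMap.smul_apply, Basis.coord_apply, Basis.repr_self,
    Finsupp.single_apply, smul_eq_mul]
  rcases Fin.eq_castSucc_or_eq_last i with ⟨i, rfl⟩ | rfl
  · rw [hb, h.metric_transverseCoframe_left]
    rcases Fin.eq_castSucc_or_eq_last i with ⟨i, rfl⟩ | rfl
    · simp [gram]
    · simp [h.lorentzian.symm _ (e (d (Fin.last (n + 2)))), h.null, (Fin.castSucc_ne_last _).symm]
  · simp [h.lorentzian.symm _ (b (Fin.last (n + 3))), hb_last, (Fin.castSucc_ne_last _).symm]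

theorem mem_degeneracyFibre_iff_coordStarSum (hβ : β (d (Fin.last (n + 2))) = 1)
    {Ω : T [⋀^Fin (n + 3)]→ₗ[ℝ] ℝ} (hΩ : Ω ≠ 0) {W : Dual ℝ V [⋀^Fin (n + 4)]→ₗ[ℝ] ℝ}
    (hW : W ≠ 0) {τ : BiForm T V (n + 1) (n + 3)} :
    τ ∈ degeneracyFibre n η e (transverseCoframe e β (d (Fin.last (n + 2)))) ↔
      ∃ A, (gram η e (fun j : Fin (n + 2) => d j.castSucc) * A).IsSymm ∧ A.trace = 0 ∧
        τ = coordStarSum d b Ω W A := by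
  have hd := coe_reindex_finRotate d
  have h_indep := hd ▸ (d.reindex (finRotate _)).linearIndependent
  have h_unit := (h.gram_isAnisotropic h_indep).isUnit_det
  have hθ := funext (h.metric_transverseCoframe_eq_sum_coord hb hb_last)
  simp only [h.mem_degeneracyFibre_iff hβ hd b.dualBasis hΩ hW, hθ, starSum_sum_smul,
    isSymm_mul_iff_exists_isSymm h.gram_isSymm h_unit]
  constructor
  · rintro ⟨B, hB, h_trace, rfl⟩
    exact ⟨_, ⟨B, hB, rfl⟩, h_trace, rfl⟩
  · rintro ⟨_, ⟨B, hB, rfl⟩, h_trace, rfl⟩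
    exact ⟨B, hB, h_trace, rfl⟩

end IsLightLike

theorem compX_coordStarSum_eq_iff (d : Fin (n + 3) → T) (b : Basis (Fin (n + 4)) ℝ V)
    {Ω : T [⋀^Fin (n + 3)]→ₗ[ℝ] ℝ} {W : Dual ℝ V [⋀^Fin (n + 4)]→ₗ[ℝ] ℝ}
    (hκ : coordStarFactor d b Ω W ≠ 0) {G : Matrix (Fin (n + 2)) (Fin (n + 2)) ℝ}
    {f : Fin (n + 2) → Fin (n + 2) →
        (({p : Fin (n + 2) × Fin (n + 2) // p.1 < p.2} → ℝ) × (Fin (n + 2) → ℝ)) →ₗ[ℝ] ℝ}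
    (hf : ∀ Z, (G * Z).IsSymm ↔
      ∀ i j, i < j → Z j i = f i j (fun p => Z p.1.1 p.1.2, fun i => -Z i i))
    (A : Matrix (Fin (n + 2)) (Fin (n + 2)) ℝ) :
    (∀ μ₁ μ₂ : Fin (n + 2), μ₁ < μ₂ → compX d b (coordStarSum d b Ω W A) μ₁ μ₂ =
      f μ₁ μ₂ (fun p => compX d b (coordStarSum d b Ω W A) p.1.2 p.1.1,
        compY d b (coordStarSum d b Ω W A))) ↔ (G * A).IsSymm := by
  let Z := -coordStarFactor d b Ω W • A
  have hX (μ ν : Fin (n + 2)) (h : μ ≠ ν) : compX d b (coordStarSum d b Ω W A) μ ν = Z ν μ := by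
    simp [Z, compX_coordStarSum d b Ω W A h]
  have hX' : (fun p : {p : Fin (n + 2) × Fin (n + 2) // p.1 < p.2} =>
      compX d b (coordStarSum d b Ω W A) p.1.2 p.1.1) = fun p => Z p.1.1 p.1.2 :=
    funext fun p => hX _ _ p.2.ne'
  have hY : compY d b (coordStarSum d b Ω W A) = fun i => -Z i i :=
    funext fun i => by simp [Z, compY_coordStarSum]
  have hZ : (G * A).IsSymm ↔ (G * Z).IsSymm := by
    rw [Matrix.mul_smul, Matrix.IsSymm, Matrix.IsSymm, Matrix.transpose_smul]
    exact (smul_right_injective _ (neg_ne_zero.mpr hκ)).eq_iff.symm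
  rw [hZ, hf, hX', hY]
  exact forall₃_congr fun i j hij => by rw [hX i j hij.ne]

theorem IsLightLike.mem_degeneracyFibre_iff_component {m : ℕ} {η : V →ₗ[ℝ] Dual ℝ V}
    {e : T →ₗ[ℝ] V} {β : Dual ℝ T} {d : Basis (Fin (n + 3)) ℝ T}
    (h : IsLightLike m η e (d (Fin.last (n + 2)))) (hβ : β (d (Fin.last (n + 2))) = 1)
    {b : Basis (Fin (n + 4)) ℝ V} (hb : ∀ i, b i.castSucc = e (d i))
    (hb_last : ∀ u, η (b (Fin.last (n + 3))) (transverseCoframe e β (d (Fin.last (n + 2))) u) = 0)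
    {f : Fin (n + 2) → Fin (n + 2) →
        (({p : Fin (n + 2) × Fin (n + 2) // p.1 < p.2} → ℝ) × (Fin (n + 2) → ℝ)) →ₗ[ℝ] ℝ}
    (hf : ∀ Z, (gram η e (fun j : Fin (n + 2) => d j.castSucc) * Z).IsSymm ↔
      ∀ i j, i < j → Z j i = f i j (fun p => Z p.1.1 p.1.2, fun i => -Z i i))
    (τ : BiForm T V (n + 1) (n + 3)) :
    τ ∈ degeneracyFibre n η e (transverseCoframe e β (d (Fin.last (n + 2)))) ↔
      (∀ I J, component d b τ I J ≠ 0 → IsXYIndex I J) ∧ ∑ μ, compY d b τ μ = 0 ∧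
        ∀ μ₁ μ₂ : Fin (n + 2), μ₁ < μ₂ → compX d b τ μ₁ μ₂ =
          f μ₁ μ₂ (fun p => compX d b τ p.1.2 p.1.1, compY d b τ) := by
  have hΩ : d.det ≠ 0 := d.det_ne_zero
  have hW : b.dualBasis.det ≠ 0 := b.dualBasis.det_ne_zero
  have hκ := coordStarFactor_ne_zero d b hΩ hW
  have h_trace (A : Matrix (Fin (n + 2)) (Fin (n + 2)) ℝ) :
      ∑ μ, compY d b (coordStarSum d b d.det b.dualBasis.det A) μ = 0 ↔ A.trace = 0 := by
    simp only [compY_coordStarSum, ← Finset.mul_sum, Matrix.trace, Matrix.diag_apply,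
      mul_eq_zero, hκ, false_or]
  rw [h.mem_degeneracyFibre_iff_coordStarSum hb hb_last hβ hΩ hW]
  constructor
  · rintro ⟨A, hA, hA_trace, rfl⟩
    exact ⟨fun _ _ => isXYIndex_of_component_coordStarSum_ne_zero d b _ _ A,
      (h_trace A).mpr hA_trace, (compX_coordStarSum_eq_iff d b hκ hf A).mpr hA⟩
  · rintro ⟨hXY, hY, hX⟩
    obtain ⟨A, rfl⟩ := exists_eq_coordStarSum b _ _ d hκ hXY
    exact ⟨A, (compX_coordStarSum_eq_iff d b hκ hf A).mp hX, (h_trace A).mp hY, rfl⟩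

end ComponentDescription

section KernelFrame

variable {K M ι : Type*} [Field K] [AddCommGroup M] [Module K M]

/-- Vectors in the kernel of the functional `l`, obtained from the vectors `v` by eliminating
`v i₀`. The denominator `l (v i₀)` is cleared, so that they depend polynomially on `l`. -/
def kernelFrame (v : ι → M) (l : Dual K M) (i₀ : ι) (i : {i // i ≠ i₀}) : M :=
  l (v i₀) • v i - l (v i) • v i₀

variable {v : ι → M} {l : Dual K M} {i₀ : ι}

theorem map_kernelFrame (i : {i // i ≠ i₀}) : l (kernelFrame v l i₀ i) = 0 := by
  simp [kernelFrame, mul_comm]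

theorem sum_smul_kernelFrame [Fintype ι] [DecidableEq ι] (c : {i // i ≠ i₀} → K) :
    ∑ i, c i • kernelFrame v l i₀ i =
      l (v i₀) • ∑ i, c i • v i.1 - (∑ i, c i * l (v i)) • v i₀ := by
  simp only [kernelFrame, smul_sub, Finset.sum_sub_distrib, Finset.smul_sum, Finset.sum_smul,
    smul_smul, mul_comm]

theorem linearIndependent_kernelFrame [Finite ι] (hl : l (v i₀) ≠ 0) (hv : LinearIndependent K v) :
    LinearIndependent K (kernelFrame v l i₀) := by
  classical
  have := Fintype.ofFinite ι
  refine Fintype.linearIndependent_iff.mpr fun c hc i => ?_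
  let c' (j : ι) : K := if h : j = i₀ then -∑ i, c i * l (v i) else l (v i₀) * c ⟨j, h⟩
  have h_eliminated : c' i₀ = -∑ i, c i * l (v i) := dif_pos rfl
  have h_other (i : {i // i ≠ i₀}) : c' i = l (v i₀) * c i := dif_neg i.2
  have h_sum : ∑ j, c' j • v j = 0 := by
    rw [← hc, sum_smul_kernelFrame, Fintype.sum_eq_add_sum_subtype_ne _ i₀, Finset.smul_sum,
      sub_eq_neg_add, ← neg_smul]
    simp only [h_eliminated, h_other, mul_smul]
  have h := Fintype.linearIndependent_iff.mp hv c' h_sum i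
  rw [h_other] at h
  exact (mul_eq_zero.mp h).resolve_left hl

theorem sum_smul_eq_sum_kernelFrame [Fintype ι] [DecidableEq ι] (hl : l (v i₀) ≠ 0) {c : ι → K}
    (h : l (∑ i, c i • v i) = 0) :
    ∑ i, c i • v i = ∑ i : {i // i ≠ i₀}, ((l (v i₀))⁻¹ * c i) • kernelFrame v l i₀ i := by
  rw [Fintype.sum_eq_add_sum_subtype_ne _ i₀] at h ⊢
  simp only [map_add, map_sum, map_smul, smul_eq_mul] at h
  rw [sum_smul_kernelFrame, sub_eq_neg_add, ← neg_smul]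
  simp only [mul_smul, mul_assoc, ← Finset.smul_sum, ← Finset.mul_sum, smul_inv_smul₀ hl]
  rw [← mul_neg, ← eq_neg_of_add_eq_zero_left h, mul_comm (c i₀), inv_mul_cancel_left₀ hl]

end KernelFrame

section TracelessSymmetric

variable {K ι : Type*} [Field K] [DecidableEq ι]

/-- The symmetric matrix with entries `1` at the positions `(i, j)` and `(j, i)`, for `z = s(i, j)`,
and `0` elsewhere. -/
def symUnit (K : Type*) [Field K] (z : Sym2 ι) : Matrix ι ι K :=
  Matrix.of fun i j => if s(i, j) = z then 1 else 0

theorem symUnit_isSymm (z : Sym2 ι) : (symUnit K z).IsSymm :=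
  Matrix.ext fun i j => by simp only [symUnit, Matrix.transpose_apply, Matrix.of_apply,
    Sym2.eq_swap (a := j)]

theorem sum_smul_symUnit_apply [Fintype ι] (c : Sym2 ι → K) (i j : ι) :
    (∑ z, c z • symUnit K z) i j = c s(i, j) := by
  simp [Matrix.sum_apply, symUnit]

theorem linearIndependent_symUnit [Finite ι] :
    LinearIndependent K (symUnit K : Sym2 ι → Matrix ι ι K) := by
  have := Fintype.ofFinite ι
  refine Fintype.linearIndependent_iff.mpr fun c hc z => ?_
  induction z with
  | _ i j => rw [← sum_smul_symUnit_apply c, hc, Matrix.zero_apply]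

variable [Fintype ι]

theorem eq_sum_symUnit_of_isSymm {B : Matrix ι ι K} (hB : B.IsSymm) :
    B = ∑ z : Sym2 ι, B z.out.1 z.out.2 • symUnit K z := by
  ext i j
  rw [sum_smul_symUnit_apply]
  have h_out : s(s(i, j).out.1, s(i, j).out.2) = s(i, j) := Quot.out_eq _
  rcases Sym2.eq_iff.mp h_out with ⟨h_fst, h_snd⟩ | ⟨h_fst, h_snd⟩
  · rw [h_fst, h_snd]
  · rw [h_fst, h_snd, hB.apply]

/-- The functional `B ↦ tr (B G)`. -/
def traceMul (G : Matrix ι ι K) : Dual K (Matrix ι ι K) :=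
  Matrix.traceLinearMap ι K K ∘ₗ LinearMap.mulRight K G

theorem traceMul_apply (G B : Matrix ι ι K) : traceMul G B = (B * G).trace := rfl

theorem traceMul_symUnit_diag (G : Matrix ι ι K) (i : ι) :
    traceMul G (symUnit K s(i, i)) = G i i := by
  simp [traceMul_apply, Matrix.trace, Matrix.mul_apply, symUnit, ite_and]

/-- A basis of the space of symmetric matrices `B` with `tr (B G) = 0`, if `G i₀ i₀ ≠ 0`. -/
def tracelessFrame (G : Matrix ι ι K) (i₀ : ι) (z : {z // z ≠ s(i₀, i₀)}) : Matrix ι ι K :=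
  kernelFrame (symUnit K) (traceMul G) s(i₀, i₀) z

variable {G : Matrix ι ι K} {i₀ : ι}

theorem tracelessFrame_isSymm (z : {z // z ≠ s(i₀, i₀)}) : (tracelessFrame G i₀ z).IsSymm :=
  ((symUnit_isSymm _).smul _).sub ((symUnit_isSymm _).smul _)

theorem trace_tracelessFrame_mul (z : {z // z ≠ s(i₀, i₀)}) :
    (tracelessFrame G i₀ z * G).trace = 0 :=
  map_kernelFrame (v := symUnit K) (l := traceMul G) z

theorem linearIndependent_tracelessFrame (hG : G i₀ i₀ ≠ 0) :
    LinearIndependent K (tracelessFrame G i₀) :=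
  linearIndependent_kernelFrame (by rwa [traceMul_symUnit_diag]) linearIndependent_symUnit

theorem eq_sum_tracelessFrame (hG : G i₀ i₀ ≠ 0) {B : Matrix ι ι K} (hB : B.IsSymm)
    (h_trace : (B * G).trace = 0) :
    B = ∑ z : {z // z ≠ s(i₀, i₀)},
      ((G i₀ i₀)⁻¹ * B z.1.out.1 z.1.out.2) • tracelessFrame G i₀ z := by
  have hl : traceMul G (symUnit K s(i₀, i₀)) ≠ 0 := by rwa [traceMul_symUnit_diag]
  conv_lhs => rw [eq_sum_symUnit_of_isSymm hB]
  rw [sum_smul_eq_sum_kernelFrame hl, traceMul_symUnit_diag]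
  · rfl
  · rwa [← eq_sum_symUnit_of_isSymm hB]

end TracelessSymmetric

section FibreFrame

open Matrix (vecCons)

theorem card_sym2_ne (n : ℕ) : Fintype.card {z : Sym2 (Fin (n + 2)) // z ≠ s(0, 0)} =
    (n + 4) * (n + 1) / 2 := by
  rw [Fintype.card_subtype_compl (fun z : Sym2 (Fin (n + 2)) => z = s(0, 0)), Sym2.card,
    Fintype.card_subtype_eq, Fintype.card_fin, Nat.choose_two_right]
  have : (n + 2 + 1) * (n + 2 + 1 - 1) = (n + 4) * (n + 1) + 2 := by
    rw [Nat.add_sub_cancel]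
    ring
  omega

variable {T V : Type*} [AddCommGroup T] [Module ℝ T] [AddCommGroup V] [Module ℝ V] {n : ℕ}

theorem starSum_apply_removeNth (Ω : T [⋀^Fin (n + 3)]→ₗ[ℝ] ℝ)
    (W : Dual ℝ V [⋀^Fin (n + 4)]→ₗ[ℝ] ℝ) (x : T) (Y : Fin (n + 2) → T)
    {θ φ : Fin (n + 2) → Dual ℝ V} (κ : Dual ℝ V) {ψ : Dual ℝ V} {r : Fin (n + 2) → ℝ}
    (hθ : ∀ ν, θ ν = φ ν - r ν • ψ) (B : Matrix (Fin (n + 2)) (Fin (n + 2)) ℝ)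
    (ν μ : Fin (n + 2)) :
    starSum Ω W x Y θ B (ν.removeNth Y) (vecCons κ (vecCons ψ (μ.removeNth φ))) =
      (-1) ^ (ν : ℕ) * (-1) ^ (μ : ℕ) * (Ω (vecCons x Y) * W (vecCons κ (vecCons ψ φ))) *
        B ν μ := by
  let Ωx := Ω.curryLeft x
  let Wκψ := (W.curryLeft κ).curryLeft ψ
  have h_form (j : Fin (n + 2)) : Ω (vecCons x (vecCons (Y j) (ν.removeNth Y))) =
      if j = ν then (-1) ^ (ν : ℕ) * Ωx Y else 0 :=
    map_vecCons_removeNth Ωx ν j Y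
  have h_coform (a : Fin (n + 2)) : W (vecCons (θ a) (vecCons κ (vecCons ψ (μ.removeNth φ)))) =
      if a = μ then (-1) ^ (μ : ℕ) * Wκψ φ else 0 := by
    have h_move (α : Dual ℝ V) : W (vecCons α (vecCons κ (vecCons ψ (μ.removeNth φ)))) =
        Wκψ.curryLeft α (μ.removeNth φ) := by
      rw [map_vecCons_swap, ← AlternatingMap.curryLeft_apply_apply, map_vecCons_swap, neg_neg]
      rfl
    have h_same : Wκψ.curryLeft ψ = 0 := (W.curryLeft κ).curryLeft_same ψ
    rw [h_move, hθ, map_sub, map_smul, h_same, smul_zero, sub_zero]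
    exact map_vecCons_removeNth Wκψ μ a φ
  simp only [starSum_apply, h_form, h_coform, ite_mul, mul_ite, zero_mul, mul_zero,
    Finset.sum_ite_eq', Finset.mem_univ, if_true]
  change _ = (-1) ^ (ν : ℕ) * (-1) ^ (μ : ℕ) * (Ωx Y * Wκψ φ) * B ν μ
  ring

/-- The inverse of `B ↦ starSum Ω W x Y θ B`, if `θ ν` and `φ ν` agree modulo `ψ`. -/
noncomputable def starEntries (Ω : T [⋀^Fin (n + 3)]→ₗ[ℝ] ℝ)
    (W : Dual ℝ V [⋀^Fin (n + 4)]→ₗ[ℝ] ℝ) (x : T) (Y : Fin (n + 2) → T) (κ ψ : Dual ℝ V)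
    (φ : Fin (n + 2) → Dual ℝ V) (τ : BiForm T V (n + 1) (n + 3)) :
    Matrix (Fin (n + 2)) (Fin (n + 2)) ℝ :=
  Matrix.of fun ν μ => (-1) ^ (ν : ℕ) * (-1) ^ (μ : ℕ) *
    (Ω (vecCons x Y) * W (vecCons κ (vecCons ψ φ)))⁻¹ *
    τ (ν.removeNth Y) (vecCons κ (vecCons ψ (μ.removeNth φ)))

theorem starEntries_starSum {Ω : T [⋀^Fin (n + 3)]→ₗ[ℝ] ℝ}
    {W : Dual ℝ V [⋀^Fin (n + 4)]→ₗ[ℝ] ℝ} {x : T} {Y : Fin (n + 2) → T}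
    {θ φ : Fin (n + 2) → Dual ℝ V} {κ ψ : Dual ℝ V} {r : Fin (n + 2) → ℝ}
    (hθ : ∀ ν, θ ν = φ ν - r ν • ψ) (hΩ : Ω (vecCons x Y) ≠ 0)
    (hW : W (vecCons κ (vecCons ψ φ)) ≠ 0) (B : Matrix (Fin (n + 2)) (Fin (n + 2)) ℝ) :
    starEntries Ω W x Y κ ψ φ (starSum Ω W x Y θ B) = B := by
  ext ν μ
  rw [starEntries, Matrix.of_apply, starSum_apply_removeNth Ω W x Y κ hθ]
  have h_sign (i : ℕ) : (-1 : ℝ) ^ i * (-1) ^ i = 1 := pow_mul_pow_eq_one i (by norm_num)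
  calc _ = (Ω (vecCons x Y) * W (vecCons κ (vecCons ψ φ)))⁻¹ *
        (Ω (vecCons x Y) * W (vecCons κ (vecCons ψ φ))) *
        ((-1) ^ (ν : ℕ) * (-1) ^ (ν : ℕ)) * ((-1) ^ (μ : ℕ) * (-1) ^ (μ : ℕ)) * B ν μ := by ring
    _ = B ν μ := by
      rw [inv_mul_cancel₀ (mul_ne_zero hΩ hW), h_sign, h_sign, one_mul, one_mul, one_mul]

/-- A basis of the space of all `τ` with `τ ∧ e = 0` and `[τ, ẽ] = 0`. -/
noncomputable def fibreFrame (Ω : T [⋀^Fin (n + 3)]→ₗ[ℝ] ℝ) (W : Dual ℝ V [⋀^Fin (n + 4)]→ₗ[ℝ] ℝ)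
    (η : V →ₗ[ℝ] Dual ℝ V) (e : T →ₗ[ℝ] V) (β : Dual ℝ T) (x : T) (Y : Fin (n + 2) → T)
    (z : {z : Sym2 (Fin (n + 2)) // z ≠ s(0, 0)}) : BiForm T V (n + 1) (n + 3) :=
  starSum Ω W x Y (fun ν => η (transverseCoframe e β x (Y ν))) (tracelessFrame (gram η e Y) 0 z)

/-- The coefficients with respect to `fibreFrame`. They depend on a covector `κ` transversal to
`η(e)`, but only through formulas that are smooth in all the data. -/
noncomputable def fibreCoeff (Ω : T [⋀^Fin (n + 3)]→ₗ[ℝ] ℝ) (W : Dual ℝ V [⋀^Fin (n + 4)]→ₗ[ℝ] ℝ)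
    (η : V →ₗ[ℝ] Dual ℝ V) (e : T →ₗ[ℝ] V) (κ : Dual ℝ V) (x : T) (Y : Fin (n + 2) → T)
    (τ : BiForm T V (n + 1) (n + 3)) (z : Sym2 (Fin (n + 2))) : ℝ :=
  (gram η e Y 0 0)⁻¹ *
    starEntries Ω W x Y κ (η (e x)) (fun ν => η (e (Y ν))) τ z.out.1 z.out.2

namespace IsLightLike

variable {η : V →ₗ[ℝ] Dual ℝ V} {e : T →ₗ[ℝ] V} {x : T} {Y : Fin (n + 2) → T}

theorem gram_apply_self_ne_zero {m : ℕ} (h : IsLightLike m η e x)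
    (hY : LinearIndependent ℝ (vecCons x Y)) (i : Fin (n + 2)) : gram η e Y i i ≠ 0 := fun hi => by
  have := h.gram_isAnisotropic hY (Pi.single i 1) (by simpa using hi)
  simpa using congrFun this i

variable {m : ℕ} (h : IsLightLike m η e x) {β : Dual ℝ T} (hβ : β x = 1)
  {d : Basis (Fin (n + 3)) ℝ T} (hd : ⇑d = vecCons x Y)
  {c : Basis (Fin (n + 4)) ℝ (Dual ℝ V)} {κ : Dual ℝ V}
  (hc : ⇑c = vecCons κ (vecCons (η (e x)) fun ν => η (e (Y ν))))
  {Ω : T [⋀^Fin (n + 3)]→ₗ[ℝ] ℝ} (hΩ : Ω ≠ 0) {W : Dual ℝ V [⋀^Fin (n + 4)]→ₗ[ℝ] ℝ} (hW : W ≠ 0)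

include hd hc hΩ hW in
theorem starEntries_starSum_transverseCoframe (B : Matrix (Fin (n + 2)) (Fin (n + 2)) ℝ) :
    starEntries Ω W x Y κ (η (e x)) (fun ν => η (e (Y ν)))
      (starSum Ω W x Y (fun ν => η (transverseCoframe e β x (Y ν))) B) = B :=
  starEntries_starSum (fun ν => by rw [transverseCoframe_apply, map_sub, map_smul])
    (hd ▸ (Ω.map_basis_ne_zero_iff d).mpr hΩ) (hc ▸ (W.map_basis_ne_zero_iff c).mpr hW) B

include h hβ hd in
theorem fibreFrame_mem (c : Basis (Fin (n + 4)) ℝ (Dual ℝ V)) (Ω : T [⋀^Fin (n + 3)]→ₗ[ℝ] ℝ)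
    (W : Dual ℝ V [⋀^Fin (n + 4)]→ₗ[ℝ] ℝ) (z : {z : Sym2 (Fin (n + 2)) // z ≠ s(0, 0)}) :
    fibreFrame Ω W η e β x Y z ∈ degeneracyFibre n η e (transverseCoframe e β x) := by
  by_cases h_zero : Ω = 0 ∨ W = 0
  · convert Submodule.zero_mem _
    ext u ξ
    rcases h_zero with rfl | rfl <;> simp [fibreFrame, starSum_apply]
  · obtain ⟨hΩ, hW⟩ := not_or.mp h_zero
    exact (h.mem_degeneracyFibre_iff hβ hd c hΩ hW).mpr
      ⟨_, tracelessFrame_isSymm z, trace_tracelessFrame_mul z, rfl⟩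

include h hd hc hΩ hW

theorem linearIndependent_fibreFrame : LinearIndependent ℝ (fibreFrame Ω W η e β x Y) := by
  have h_inj : Function.Injective
      (starSum Ω W x Y fun ν => η (transverseCoframe e β x (Y ν))) := fun B B' hB => by
    rw [← starEntries_starSum_transverseCoframe (β := β) hd hc hΩ hW B, hB,
      starEntries_starSum_transverseCoframe hd hc hΩ hW]
  have h_ne := h.gram_apply_self_ne_zero (hd ▸ d.linearIndependent) (0 : Fin (n + 2))
  exact (linearIndependent_tracelessFrame h_ne).map_injOn
    (starSum Ω W x Y fun ν => η (transverseCoframe e β x (Y ν))) h_inj.injOn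

include hβ

theorem sum_fibreCoeff_smul_fibreFrame {τ : BiForm T V (n + 1) (n + 3)}
    (hτ : τ ∈ degeneracyFibre n η e (transverseCoframe e β x)) :
    ∑ z : {z : Sym2 (Fin (n + 2)) // z ≠ s(0, 0)},
      fibreCoeff Ω W η e κ x Y τ z • fibreFrame Ω W η e β x Y z = τ := by
  obtain ⟨B, hB, h_trace, rfl⟩ := (h.mem_degeneracyFibre_iff hβ hd c hΩ hW).mp hτ
  have h_ne := h.gram_apply_self_ne_zero (hd ▸ d.linearIndependent) (0 : Fin (n + 2))
  conv_rhs => rw [eq_sum_tracelessFrame h_ne hB h_trace, map_sum]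
  simp only [fibreCoeff, starEntries_starSum_transverseCoframe hd hc hΩ hW, fibreFrame, map_smul]

end IsLightLike

section Finrank

variable {η : V →ₗ[ℝ] Dual ℝ V} {e : T →ₗ[ℝ] V} {x : T} {Y : Fin (n + 2) → T}
  (h : IsLightLike (n + 3) η e x) {d : Basis (Fin (n + 3)) ℝ T} (hd : ⇑d = vecCons x Y)
include h hd

theorem IsLightLike.exists_covectorBasis :
    ∃ (k : V) (c : Basis (Fin (n + 4)) ℝ (Dual ℝ V)),
      ⇑c = vecCons (η k) (vecCons (η (e x)) fun ν => η (e (Y ν))) := by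
  obtain ⟨k, c, hc⟩ := h.lorentzian.exists_dualBasis_metric
    (d.linearIndependent.map_injOn e h.injective.injOn)
  refine ⟨k, c, hc.trans (congrArg (vecCons (η k)) ?_)⟩
  rw [hd]
  exact Fin.comp_cons (fun u => η (e u)) x Y

theorem IsLightLike.finrank_degeneracyFibre {β : Dual ℝ T} (hβ : β x = 1) :
    finrank ℝ (degeneracyFibre n η e (transverseCoframe e β x)) = (n + 4) * (n + 1) / 2 := by
  obtain ⟨k, c, hc⟩ := h.exists_covectorBasis hd
  have h_span : Submodule.span ℝ (Set.range (fibreFrame d.det c.det η e β x Y)) =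
      degeneracyFibre n η e (transverseCoframe e β x) := by
    refine le_antisymm (Submodule.span_le.mpr ?_) fun τ hτ => ?_
    · rintro _ ⟨z, rfl⟩
      exact h.fibreFrame_mem hβ hd c _ _ z
    · rw [← h.sum_fibreCoeff_smul_fibreFrame hβ hd hc d.det_ne_zero c.det_ne_zero hτ]
      exact Submodule.sum_mem _ fun z _ =>
        Submodule.smul_mem _ _ (Submodule.subset_span ⟨z, rfl⟩)
  rw [← h_span, finrank_span_eq_card
    (h.linearIndependent_fibreFrame hd hc d.det_ne_zero c.det_ne_zero), card_sym2_ne]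

end Finrank

end FibreFrame

/-! ### Smooth fields of forms -/

section DualDet

open Matrix (vecCons)

variable {V : Type*} [AddCommGroup V] [Module ℝ V] {m : ℕ}

/-- The alternating form `(ξ₁, …, ξ_m) ↦ det (ξ_i (v_j))` on the dual space, i.e. `v₁ ∧ ⋯ ∧ v_m`. -/
noncomputable def dualDet (v : Fin m → V) : Dual ℝ V [⋀^Fin m]→ₗ[ℝ] ℝ :=
  Matrix.detRowAlternating.compLinearMap (LinearMap.pi fun j => Dual.eval ℝ V (v j))

theorem dualDet_apply (v : Fin m → V) (ξ : Fin m → Dual ℝ V) :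
    dualDet v ξ = (Matrix.of fun i j => ξ i (v j)).det := rfl

theorem dualDet_ne_zero (v : Basis (Fin m) ℝ V) : dualDet v ≠ 0 := fun h => by
  have h_one : (Matrix.of fun i j => v.dualBasis i (v j)) = 1 := by
    ext i j
    simp [Matrix.one_apply, Finsupp.single_apply, eq_comm]
  have h_zero : dualDet v v.dualBasis = 0 := by rw [h, AlternatingMap.zero_apply]
  rw [dualDet_apply, h_one, Matrix.det_one] at h_zero
  exact one_ne_zero h_zero

theorem exists_basis_of_map_ne_zero {K E ι : Type*} [Field K] [AddCommGroup E] [Module K E]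
    [Fintype ι] [Nonempty ι] (h_card : Fintype.card ι = finrank K E) {f : E [⋀^ι]→ₗ[K] K}
    {v : ι → E} (hv : f v ≠ 0) : ∃ b : Basis ι K E, ⇑b = v := by
  have h_indep : LinearIndependent K v := by
    by_contra h
    exact hv (f.map_linearDependent v h)
  exact ⟨basisOfLinearIndependentOfCardEqFinrank h_indep h_card,
    coe_basisOfLinearIndependentOfCardEqFinrank _ _⟩

end DualDet

section SmoothMatrices

variable {H₀ H M : Type*} [NormedAddCommGroup H₀] [NormedSpace ℝ H₀] [TopologicalSpace H]
  {I : ModelWithCorners ℝ H₀ H} [TopologicalSpace M] [ChartedSpace H M] {k : WithTop ℕ∞}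
  {ι : Type*} [Fintype ι] [DecidableEq ι] {U : Set M}

theorem contMDiffOn_det {A : M → Matrix ι ι ℝ}
    (hA : ∀ i j, ContMDiffOn I 𝓘(ℝ, ℝ) k (fun x => A x i j) U) :
    ContMDiffOn I 𝓘(ℝ, ℝ) k (fun x => (A x).det) U := by
  simp only [Matrix.det_apply']
  exact contMDiffOn_finsetSum fun σ _ => contMDiffOn_const.mul
    (contMDiffOn_finsetProd fun i _ => hA _ _)

theorem contMDiffOn_tracelessFrame {G : M → Matrix ι ι ℝ}
    (hG : ∀ i j, ContMDiffOn I 𝓘(ℝ, ℝ) k (fun x => G x i j) U) (i₀ : ι)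
    (z : {z // z ≠ s(i₀, i₀)}) (i j : ι) :
    ContMDiffOn I 𝓘(ℝ, ℝ) k (fun x => tracelessFrame (G x) i₀ z i j) U := by
  have h_trace (B : Matrix ι ι ℝ) :
      ContMDiffOn I 𝓘(ℝ, ℝ) k (fun x => traceMul (G x) B) U := by
    simp only [traceMul_apply, Matrix.trace, Matrix.diag_apply, Matrix.mul_apply]
    exact contMDiffOn_finsetSum fun a _ => contMDiffOn_finsetSum fun b _ =>
      contMDiffOn_const.mul (hG b a)
  simp only [tracelessFrame, kernelFrame, Matrix.sub_apply, Matrix.smul_apply, smul_eq_mul]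
  exact ((h_trace _).mul contMDiffOn_const).sub ((h_trace _).mul contMDiffOn_const)

end SmoothMatrices

section SmoothFields

open Matrix (vecCons)

theorem vecCons_field {X : Type*} {A : X → Type*} {m : ℕ} (a : ∀ x, A x)
    (s : Fin m → ∀ x, A x) (x : X) :
    (fun i => vecCons a s i x) = vecCons (a x) fun i => s i x :=
  Fin.comp_cons (fun a : ∀ x, A x => a x) a s

theorem vecCons_covectorField {X : Type*} {A : X → Type*} [∀ x, AddCommGroup (A x)]
    [∀ x, Module ℝ (A x)] [∀ x, TopologicalSpace (A x)] {m : ℕ} (a : ∀ x, A x →L[ℝ] ℝ)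
    (s : Fin m → ∀ x, A x →L[ℝ] ℝ) (x : X) :
    (fun i => (vecCons a s i x : A x →ₗ[ℝ] ℝ)) =
      vecCons (a x : A x →ₗ[ℝ] ℝ) fun i => (s i x : A x →ₗ[ℝ] ℝ) :=
  Fin.comp_cons (fun a : ∀ x, A x →L[ℝ] ℝ => (a x : A x →ₗ[ℝ] ℝ)) a s

variable {n : ℕ} {M : Type*} [TopologicalSpace M]
  [ChartedSpace (EuclideanSpace ℝ (Fin (n + 3))) M] {F : Type*} [NormedAddCommGroup F]
  [NormedSpace ℝ F] {E : M → Type*} [TopologicalSpace (TotalSpace F E)] [∀ x, AddCommGroup (E x)]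
  [∀ x, Module ℝ (E x)] [∀ x, TopologicalSpace (E x)] [FiberBundle F E] [VectorBundle ℝ F E]

variable (n F) in
/-- A smooth section of `E` over `U`. -/
def IsSmoothSectionOn (U : Set M) (s : ∀ x : M, E x) : Prop :=
  ContMDiffOn (𝓡 (n + 3)) ((𝓡 (n + 3)).prod 𝓘(ℝ, F)) ∞ (fun x => TotalSpace.mk' F x (s x)) U

theorem IsSmoothCovectorOn.contMDiffOn_apply {U : Set M} {α : ∀ x : M, E x →L[ℝ] ℝ}
    (hα : IsSmoothCovectorOn n F U α) {s : ∀ x : M, E x} (hs : IsSmoothSectionOn n F U s) :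
    ContMDiffOn (𝓡 (n + 3)) 𝓘(ℝ, ℝ) ∞ (fun x => α x (s x)) U := by
  have h : ContMDiffOn (𝓡 (n + 3)) ((𝓡 (n + 3)).prod 𝓘(ℝ, ℝ)) ∞
      (fun x => TotalSpace.mk' ℝ (E := Bundle.Trivial M ℝ) x (α x (s x))) U :=
    ContMDiffOn.clm_bundle_apply (F₁ := F) hα hs
  exact fun x hx => (contMDiffWithinAt_totalSpace.mp (h x hx)).2

variable (n F) in
/-- A smooth section of `⋀ʲ E`, realised as a field of alternating forms on the dual bundle `E*`; as
in `IsSmoothBiForm`, smoothness is tested on smooth local sections of `E*`. -/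
def IsSmoothDualForm {j : ℕ} (W : ∀ x : M, Dual ℝ (E x) [⋀^Fin j]→ₗ[ℝ] ℝ) : Prop :=
  ∀ U : Set M, IsOpen U →
    ∀ α : Fin j → ∀ x : M, E x →L[ℝ] ℝ, (∀ c, IsSmoothCovectorOn n F U (α c)) →
      ContMDiffOn (𝓡 (n + 3)) 𝓘(ℝ, ℝ) ∞ (fun x => W x fun c => (α c x : E x →ₗ[ℝ] ℝ)) U

theorem isSmoothDualForm_dualDet {m : ℕ} {s : Fin m → ∀ x : M, E x}
    (hs : ∀ j, IsSmoothSectionOn n F Set.univ (s j)) :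
    IsSmoothDualForm n F fun x => dualDet fun j => s j x := fun U _ _ hα =>
  contMDiffOn_det fun i j => (hα i).contMDiffOn_apply ((hs j).mono (Set.subset_univ U))

variable [IsManifold (𝓡 (n + 3)) ∞ M]

/-- A smooth differential form on `M`; as in `IsSmoothBiForm`, smoothness is tested on smooth local
vector fields. -/
def IsSmoothTangentForm {i : ℕ} (Ω : ∀ x : M, TangentSpace (𝓡 (n + 3)) x [⋀^Fin i]→ₗ[ℝ] ℝ) :
    Prop :=
  ∀ U : Set M, IsOpen U →
    ∀ Z : Fin i → ∀ x : M, TangentSpace (𝓡 (n + 3)) x, (∀ a, IsSmoothFieldOn n M U (Z a)) →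
      ContMDiffOn (𝓡 (n + 3)) 𝓘(ℝ, ℝ) ∞ (fun x => Ω x fun a => Z a x) U

theorem IsSmoothOneForm.contMDiffOn_apply {U : Set M}
    {β : ∀ x : M, TangentSpace (𝓡 (n + 3)) x →L[ℝ] ℝ} (hβ : IsSmoothOneForm n M β)
    {Z : ∀ x : M, TangentSpace (𝓡 (n + 3)) x} (hZ : IsSmoothFieldOn n M U Z) :
    ContMDiffOn (𝓡 (n + 3)) 𝓘(ℝ, ℝ) ∞ (fun x => β x (Z x)) U := by
  have h : ContMDiffOn (𝓡 (n + 3)) ((𝓡 (n + 3)).prod 𝓘(ℝ, ℝ)) ∞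
      (fun x => TotalSpace.mk' ℝ (E := Bundle.Trivial M ℝ) x (β x (Z x))) U :=
    ContMDiffOn.clm_bundle_apply (F₁ := EuclideanSpace ℝ (Fin (n + 3))) hβ.contMDiffOn hZ
  exact fun x hx => (contMDiffWithinAt_totalSpace.mp (h x hx)).2

theorem isSmoothBiForm_starSum {ι : Type*} [Fintype ι] {i j : ℕ}
    {Ω : ∀ x : M, TangentSpace (𝓡 (n + 3)) x [⋀^Fin (i + 2)]→ₗ[ℝ] ℝ} (hΩ : IsSmoothTangentForm Ω)
    {W : ∀ x : M, Dual ℝ (E x) [⋀^Fin (j + 1)]→ₗ[ℝ] ℝ} (hW : IsSmoothDualForm n F W)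
    {X : ∀ x : M, TangentSpace (𝓡 (n + 3)) x} (hX : IsSmoothFieldOn n M Set.univ X)
    {Y : ι → ∀ x : M, TangentSpace (𝓡 (n + 3)) x} (hY : ∀ ν, IsSmoothFieldOn n M Set.univ (Y ν))
    {θ : ι → ∀ x : M, E x →L[ℝ] ℝ} (hθ : ∀ ν, IsSmoothCovectorOn n F Set.univ (θ ν))
    {B : M → Matrix ι ι ℝ}
    (hB : ∀ a ν, ContMDiffOn (𝓡 (n + 3)) 𝓘(ℝ, ℝ) ∞ (fun x => B x a ν) Set.univ) :
    IsSmoothBiForm n F fun x =>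
      starSum (Ω x) (W x) (X x) (fun ν => Y ν x) (fun ν => (θ ν x : E x →ₗ[ℝ] ℝ)) (B x) := by
  intro U hU Z hZ α hα
  simp only [starSum_apply]
  refine contMDiffOn_finsetSum fun a _ => contMDiffOn_finsetSum fun ν _ =>
    ((hB a ν).mono (Set.subset_univ U)).mul (ContMDiffOn.mul ?_ ?_)
  · simpa only [vecCons_field] using hΩ U hU (vecCons X (vecCons (Y a) Z))
      (Fin.cases (hX.mono (Set.subset_univ U)) (Fin.cases ((hY a).mono (Set.subset_univ U)) hZ))
  · simpa only [vecCons_covectorField] using hW U hU (vecCons (θ ν) α)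
      (Fin.cases ((hθ ν).mono (Set.subset_univ U)) hα)

variable [ContMDiffVectorBundle ∞ F E (𝓡 (n + 3))]

variable (n F) in
theorem exists_isSmoothSectionOn_univ [T2Space M] (p : M) (v : E p) :
    ∃ s : ∀ x : M, E x, IsSmoothSectionOn n F Set.univ s ∧ s p = v := by
  obtain ⟨t, ht, hs⟩ := FiberBundle.exists_contMDiffOn_extend (𝓡 (n + 3)) F (k := ∞) v
  obtain ⟨f, -, hf⟩ := (SmoothBumpFunction.nhds_basis_tsupport (I := 𝓡 (n + 3)) p).mem_iff.mp
    (interior_mem_nhds.mpr ht)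
  refine ⟨fun x => f x • FiberBundle.extend F v x, ?_, by simp⟩
  exact (ContMDiffOn.smul_section_of_tsupport f.contMDiff.contMDiffOn isOpen_interior hf
    (hs.mono interior_subset)).contMDiffOn

variable [∀ x, IsTopologicalAddGroup (E x)] [∀ x, ContinuousSMul ℝ (E x)]

namespace BoundaryCoframe

variable (D : BoundaryCoframe n M F E) {U : Set M}

theorem isSmoothCovectorOn_metric {s : ∀ x : M, E x} (hs : IsSmoothSectionOn n F U s) :
    IsSmoothCovectorOn n F U fun x => D.metric x (s x) :=
  ContMDiffOn.clm_bundle_apply (F₁ := F) (F₂ := F →L[ℝ] ℝ)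
    (E₂ := fun x => E x →L[ℝ] Bundle.Trivial M ℝ x) D.metric_smooth.contMDiffOn hs

theorem isSmoothSectionOn_coframe {Z : ∀ x : M, TangentSpace (𝓡 (n + 3)) x}
    (hZ : IsSmoothFieldOn n M U Z) : IsSmoothSectionOn n F U fun x => D.coframe x (Z x) :=
  ContMDiffOn.clm_bundle_apply (F₁ := EuclideanSpace ℝ (Fin (n + 3))) D.coframe_smooth.contMDiffOn
    hZ

theorem isSmoothCovectorOn_metric_coframe {Z : ∀ x : M, TangentSpace (𝓡 (n + 3)) x}
    (hZ : IsSmoothFieldOn n M U Z) :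
    IsSmoothCovectorOn n F U fun x => D.metric x (D.coframe x (Z x)) :=
  D.isSmoothCovectorOn_metric (D.isSmoothSectionOn_coframe hZ)

theorem contMDiffOn_gram {ι : Type*} {Y : ι → ∀ x : M, TangentSpace (𝓡 (n + 3)) x}
    (hY : ∀ ν, IsSmoothFieldOn n M U (Y ν)) (i j : ι) :
    ContMDiffOn (𝓡 (n + 3)) 𝓘(ℝ, ℝ) ∞
      (fun x => gram (D.metricL x) (D.coframeL x) (fun ν => Y ν x) i j) U :=
  (D.isSmoothCovectorOn_metric_coframe (hY i)).contMDiffOn_apply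
    (D.isSmoothSectionOn_coframe (hY j))

theorem isSmoothCovectorOn_metric_transverseCoframe
    {β : ∀ x : M, TangentSpace (𝓡 (n + 3)) x →L[ℝ] ℝ} (hβ : IsSmoothOneForm n M β)
    {X Z : ∀ x : M, TangentSpace (𝓡 (n + 3)) x} (hX : IsSmoothFieldOn n M U X)
    (hZ : IsSmoothFieldOn n M U Z) :
    IsSmoothCovectorOn n F U
      fun x => D.metric x (transverseCoframe (D.coframeL x) (β x) (X x) (Z x)) :=
  D.isSmoothCovectorOn_metric (ContMDiffOn.sub_section (D.isSmoothSectionOn_coframe hZ)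
    ((hβ.contMDiffOn_apply hZ).smul_section (D.isSmoothSectionOn_coframe hX)))

theorem isSmoothTangentForm_pullback {i : ℕ}
    {W : ∀ x : M, Dual ℝ (E x) [⋀^Fin (i + 1)]→ₗ[ℝ] ℝ} (hW : IsSmoothDualForm n F W)
    {κ : ∀ x : M, E x →L[ℝ] ℝ} (hκ : IsSmoothCovectorOn n F Set.univ κ) :
    IsSmoothTangentForm fun x =>
      ((W x).curryLeft (κ x : E x →ₗ[ℝ] ℝ)).compLinearMap (D.metricL x ∘ₗ D.coframeL x) := by
  intro U hU Z hZ
  have h := hW U hU (vecCons κ fun a x => D.metric x (D.coframe x (Z a x)))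
    (Fin.cases (hκ.mono (Set.subset_univ U)) fun a => D.isSmoothCovectorOn_metric_coframe (hZ a))
  simp only [vecCons_covectorField] at h
  exact h

end BoundaryCoframe

end SmoothFields

/-! ### The local frame of `𝒮` -/

section LocalFrame

open Matrix (vecCons)

variable {n : ℕ} {M : Type*} [TopologicalSpace M]
  [ChartedSpace (EuclideanSpace ℝ (Fin (n + 3))) M]

theorem finrank_tangentSpace_eq (x : M) : finrank ℝ (TangentSpace (𝓡 (n + 3)) x) = n + 3 :=
  finrank_euclideanSpace_fin

variable [IsManifold (𝓡 (n + 3)) ∞ M] {F : Type*} [NormedAddCommGroup F] [NormedSpace ℝ F]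
  {E : M → Type*} [TopologicalSpace (TotalSpace F E)] [∀ x, AddCommGroup (E x)]
  [∀ x, Module ℝ (E x)] [∀ x, TopologicalSpace (E x)] [∀ x, IsTopologicalAddGroup (E x)]
  [∀ x, ContinuousSMul ℝ (E x)] [FiberBundle F E] [VectorBundle ℝ F E]
  [ContMDiffVectorBundle ∞ F E (𝓡 (n + 3))]

namespace NullFrame

variable {D : BoundaryCoframe n M F E} (R : NullFrame D)

theorem isLightLike (x : M) : IsLightLike (n + 3) (D.metricL x) (D.coframeL x) (R.X x) :=
  ⟨D.metric_lorentzian x, D.coframe_injective x, (R.frame x).ne_zero 0, R.X_null x⟩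

theorem exists_tangentBasis (x : M) : ∃ d : Basis (Fin (n + 3)) ℝ (TangentSpace (𝓡 (n + 3)) x),
    ⇑d = vecCons (R.X x) fun ν => R.Y ν x :=
  ⟨basisOfLinearIndependentOfCardEqFinrank (R.frame x)
    (by rw [finrank_tangentSpace_eq, Fintype.card_fin]),
    coe_basisOfLinearIndependentOfCardEqFinrank _ _⟩

variable {β : ∀ x : M, TangentSpace (𝓡 (n + 3)) x →L[ℝ] ℝ}

theorem finrank_fibreS {x : M} (hβX : β x (R.X x) = 1) :
    finrank ℝ (R.fibreS β x) = (n + 4) * (n + 1) / 2 := by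
  obtain ⟨d, hd⟩ := R.exists_tangentBasis x
  exact (R.isLightLike x).finrank_degeneracyFibre hd (β := β x) hβX

/-- The covector fields `κ`, `η(e X)`, `η(e Y₁)`, …, `η(e Y_{N-2})`. -/
noncomputable def covectorFrame (κ : ∀ x : M, E x →L[ℝ] ℝ) : Fin (n + 4) → ∀ x : M, E x →L[ℝ] ℝ :=
  vecCons κ (vecCons (fun x => D.metric x (D.coframe x (R.X x)))
    fun ν x => D.metric x (D.coframe x (R.Y ν x)))

theorem covectorFrame_apply (κ : ∀ x : M, E x →L[ℝ] ℝ) (x : M) :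
    (fun i => (R.covectorFrame κ i x : E x →ₗ[ℝ] ℝ)) =
      vecCons (κ x : E x →ₗ[ℝ] ℝ) (vecCons (D.metricL x (D.coframeL x (R.X x)))
        fun ν => D.metricL x (D.coframeL x (R.Y ν x))) := by
  rw [covectorFrame, vecCons_covectorField, vecCons_covectorField]
  rfl

variable {κ : ∀ x : M, E x →L[ℝ] ℝ} {U : Set M}

theorem isSmoothCovectorOn_covectorFrame (hκ : IsSmoothCovectorOn n F U κ) (i : Fin (n + 4)) :
    IsSmoothCovectorOn n F U (R.covectorFrame κ i) := by
  have h (Z : ∀ x : M, TangentSpace (𝓡 (n + 3)) x) (hZ : IsSmoothFieldOn n M Set.univ Z) :=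
    D.isSmoothCovectorOn_metric_coframe (hZ.mono (Set.subset_univ U))
  exact Fin.cases hκ (Fin.cases (h _ R.X_smooth) fun ν => h _ (R.Y_smooth ν)) i

theorem exists_covectorFrame_basis {x : M} {f : Dual ℝ (E x) [⋀^Fin (n + 4)]→ₗ[ℝ] ℝ}
    (hf : f (fun i => (R.covectorFrame κ i x : E x →ₗ[ℝ] ℝ)) ≠ 0) :
    ∃ c : Basis (Fin (n + 4)) ℝ (Dual ℝ (E x)), ⇑c = vecCons (κ x : E x →ₗ[ℝ] ℝ)
      (vecCons (D.metricL x (D.coframeL x (R.X x)))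
        fun ν => D.metricL x (D.coframeL x (R.Y ν x))) := by
  rw [covectorFrame_apply] at hf
  refine exists_basis_of_map_ne_zero ?_ hf
  rw [Subspace.dual_finrank_eq, (R.isLightLike x).lorentzian.finrank_eq, Fintype.card_fin]

variable (β) (Ω : ∀ x : M, TangentSpace (𝓡 (n + 3)) x [⋀^Fin (n + 3)]→ₗ[ℝ] ℝ)
  (W : ∀ x : M, Dual ℝ (E x) [⋀^Fin (n + 4)]→ₗ[ℝ] ℝ)

/-- The sections `fibreFrame` of the bundle of all `τ` with `τ ∧ e = 0` and `[τ, ẽ] = 0`. -/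
noncomputable def localFrame (z : {z : Sym2 (Fin (n + 2)) // z ≠ s(0, 0)}) (x : M) :
    BiForm (TangentSpace (𝓡 (n + 3)) x) (E x) (n + 1) (n + 3) :=
  fibreFrame (Ω x) (W x) (D.metricL x) (D.coframeL x) (β x : TangentSpace (𝓡 (n + 3)) x →ₗ[ℝ] ℝ)
    (R.X x) (fun ν => R.Y ν x) z

variable (κ) in
/-- The coefficients of `τ` with respect to `localFrame`. -/
noncomputable def localCoeff
    (τ : ∀ x : M, BiForm (TangentSpace (𝓡 (n + 3)) x) (E x) (n + 1) (n + 3))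
    (z : {z : Sym2 (Fin (n + 2)) // z ≠ s(0, 0)}) (x : M) : ℝ :=
  fibreCoeff (Ω x) (W x) (D.metricL x) (D.coframeL x) (κ x : E x →ₗ[ℝ] ℝ) (R.X x)
    (fun ν => R.Y ν x) (τ x) z

variable {β Ω W}

section Pointwise

variable {x : M}

theorem localFrame_mem (hβX : β x (R.X x) = 1) (z : {z : Sym2 (Fin (n + 2)) // z ≠ s(0, 0)}) :
    R.localFrame β Ω W z x ∈ R.fibreS β x := by
  obtain ⟨d, hd⟩ := R.exists_tangentBasis x
  obtain ⟨_, c, -⟩ := (R.isLightLike x).exists_covectorBasis hd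
  exact (R.isLightLike x).fibreFrame_mem hβX hd c _ _ _

variable (hΩ : Ω x ≠ 0) (hW : W x (fun i => (R.covectorFrame κ i x : E x →ₗ[ℝ] ℝ)) ≠ 0)
include hΩ hW

theorem linearIndependent_localFrame :
    LinearIndependent ℝ fun z => R.localFrame β Ω W z x := by
  obtain ⟨d, hd⟩ := R.exists_tangentBasis x
  obtain ⟨c, hc⟩ := R.exists_covectorFrame_basis hW
  exact (R.isLightLike x).linearIndependent_fibreFrame hd hc hΩ
    fun h => hW (by rw [h, AlternatingMap.zero_apply])

theorem sum_localCoeff_smul_localFrame (hβX : β x (R.X x) = 1)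
    {τ : ∀ x : M, BiForm (TangentSpace (𝓡 (n + 3)) x) (E x) (n + 1) (n + 3)}
    (hτ : τ x ∈ R.fibreS β x) :
    ∑ z, R.localCoeff κ Ω W τ z x • R.localFrame β Ω W z x = τ x := by
  obtain ⟨d, hd⟩ := R.exists_tangentBasis x
  obtain ⟨c, hc⟩ := R.exists_covectorFrame_basis hW
  exact (R.isLightLike x).sum_fibreCoeff_smul_fibreFrame hβX hd hc hΩ
    (fun h => hW (by rw [h, AlternatingMap.zero_apply])) hτ

end Pointwise

section Smooth

variable (hΩ : IsSmoothTangentForm Ω) (hW : IsSmoothDualForm n F W)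
include hΩ hW

theorem isSmoothBiForm_localFrame (hβ : IsSmoothOneForm n M β)
    (z : {z : Sym2 (Fin (n + 2)) // z ≠ s(0, 0)}) :
    IsSmoothBiForm n F (R.localFrame β Ω W z) :=
  isSmoothBiForm_starSum hΩ hW R.X_smooth R.Y_smooth
    (θ := fun ν x => D.metric x (transverseCoframe (D.coframeL x)
      (β x : TangentSpace (𝓡 (n + 3)) x →ₗ[ℝ] ℝ) (R.X x) (R.Y ν x)))
    (fun ν => D.isSmoothCovectorOn_metric_transverseCoframe hβ R.X_smooth (R.Y_smooth ν))
    (contMDiffOn_tracelessFrame (D.contMDiffOn_gram R.Y_smooth) 0 z)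

theorem contMDiffOn_localCoeff (hU : IsOpen U) (hκ : IsSmoothCovectorOn n F U κ)
    (hΩU : ∀ x ∈ U, Ω x (vecCons (R.X x) fun ν => R.Y ν x) ≠ 0)
    (hWU : ∀ x ∈ U, W x (fun i => (R.covectorFrame κ i x : E x →ₗ[ℝ] ℝ)) ≠ 0)
    {τ : ∀ x : M, BiForm (TangentSpace (𝓡 (n + 3)) x) (E x) (n + 1) (n + 3)}
    (hτ : IsSmoothBiForm n F τ) (z : {z : Sym2 (Fin (n + 2)) // z ≠ s(0, 0)}) :
    ContMDiffOn (𝓡 (n + 3)) 𝓘(ℝ, ℝ) ∞ (R.localCoeff κ Ω W τ z) U := by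
  have hX := R.X_smooth.mono (Set.subset_univ U)
  have hY (ν : Fin (n + 2)) := (R.Y_smooth ν).mono (Set.subset_univ U)
  have h_gram := (D.contMDiffOn_gram hY 0 0).inv₀ fun x _ => by
    obtain ⟨d, hd⟩ := R.exists_tangentBasis x
    exact (R.isLightLike x).gram_apply_self_ne_zero (hd ▸ d.linearIndependent) 0
  have h_form := hΩ U hU (vecCons R.X R.Y) (Fin.cases hX hY)
  simp only [vecCons_field] at h_form
  have h_coform := hW U hU _ (R.isSmoothCovectorOn_covectorFrame hκ)
  have h_inv := (h_form.mul h_coform).inv₀ fun x hx => mul_ne_zero (hΩU x hx) (hWU x hx)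
  have h_entry := hτ U hU (z.1.out.1.removeNth R.Y) (fun i => hY _)
    (vecCons κ (vecCons (fun x => D.metric x (D.coframe x (R.X x)))
      (z.1.out.2.removeNth fun ν x => D.metric x (D.coframe x (R.Y ν x)))))
    (Fin.cases hκ (Fin.cases (D.isSmoothCovectorOn_metric_coframe hX) fun i =>
      D.isSmoothCovectorOn_metric_coframe (hY _)))
  simp only [vecCons_covectorField] at h_entry
  simp only [covectorFrame_apply] at h_inv
  exact h_gram.mul ((contMDiffOn_const.mul h_inv).mul h_entry)

end Smooth

/-- The form `ι_κ W` on `E*`, pulled back to `TM` along `η(e)`, serves as the volume form of `TM`,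
so that nonvanishing has to be arranged only for `W`. -/
theorem exists_smooth_volumeForms [T2Space M] (p : M) :
    ∃ (κ : ∀ x : M, E x →L[ℝ] ℝ) (Ω : ∀ x : M, TangentSpace (𝓡 (n + 3)) x [⋀^Fin (n + 3)]→ₗ[ℝ] ℝ)
      (W : ∀ x : M, Dual ℝ (E x) [⋀^Fin (n + 4)]→ₗ[ℝ] ℝ), IsSmoothCovectorOn n F Set.univ κ ∧
      IsSmoothTangentForm Ω ∧ IsSmoothDualForm n F W ∧
      (∀ x, Ω x (vecCons (R.X x) fun ν => R.Y ν x) =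
        W x fun i => (R.covectorFrame κ i x : E x →ₗ[ℝ] ℝ)) ∧
      W p (fun i => (R.covectorFrame κ i p : E p →ₗ[ℝ] ℝ)) ≠ 0 := by
  obtain ⟨d, hd⟩ := R.exists_tangentBasis p
  obtain ⟨k, c, hc⟩ := (R.isLightLike p).exists_covectorBasis hd
  obtain ⟨b, -⟩ := (R.isLightLike p).lorentzian
  obtain ⟨s₀, hs₀, hs₀p⟩ := exists_isSmoothSectionOn_univ n F p k
  choose s hs hsp using fun j => exists_isSmoothSectionOn_univ n F p (b j)
  let κ (x : M) : E x →L[ℝ] ℝ := D.metric x (s₀ x)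
  let W (x : M) := dualDet fun j => s j x
  have hκ : IsSmoothCovectorOn n F Set.univ κ := D.isSmoothCovectorOn_metric hs₀
  have hW : IsSmoothDualForm n F W := isSmoothDualForm_dualDet hs
  refine ⟨κ, fun x => ((W x).curryLeft (κ x : E x →ₗ[ℝ] ℝ)).compLinearMap
    (D.metricL x ∘ₗ D.coframeL x), W, hκ, D.isSmoothTangentForm_pullback hW hκ, hW,
    fun x => ?_, ?_⟩
  · rw [covectorFrame_apply]
    exact congrArg (fun ξ => W x (vecCons (κ x : E x →ₗ[ℝ] ℝ) ξ))
      (Fin.comp_cons (fun u => D.metricL x (D.coframeL x u)) (R.X x) fun ν => R.Y ν x)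
  · have h_frame : (fun i => (R.covectorFrame κ i p : E p →ₗ[ℝ] ℝ)) = c := by
      rw [covectorFrame_apply, hc, ← hs₀p]
      rfl
    have h_form : W p = dualDet b := congrArg dualDet (funext hsp)
    rw [h_frame, h_form]
    exact ((dualDet b).map_basis_ne_zero_iff c).mpr (dualDet_ne_zero b)

theorem isLocallyFreeOfRank_spaceS [T2Space M] (hβ : IsSmoothOneForm n M β)
    (hβX : ∀ x, β x (R.X x) = 1) :
    IsLocallyFreeOfRank (R.spaceS β) ((n + 4) * (n + 1) / 2) := by
  intro p
  obtain ⟨κ, Ω, W, hκ, hΩ, hW, hΩW, hp⟩ := R.exists_smooth_volumeForms p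
  let U : Set M := {x | W x (fun i => (R.covectorFrame κ i x : E x →ₗ[ℝ] ℝ)) ≠ 0}
  have hU : IsOpen U := isOpen_ne_fun (continuousOn_univ.mp
    (hW _ isOpen_univ _ (R.isSmoothCovectorOn_covectorFrame hκ)).continuousOn) continuous_const
  have hΩU (x : M) (hx : x ∈ U) : Ω x (vecCons (R.X x) fun ν => R.Y ν x) ≠ 0 :=
    (hΩW x).trans_ne hx
  have hΩ0 (x : M) (hx : x ∈ U) : Ω x ≠ 0 := fun h =>
    hΩU x hx (by rw [h, AlternatingMap.zero_apply])
  let ε := (Fintype.equivFinOfCardEq (card_sym2_ne n)).symm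
  refine ⟨U, hU, hp, fun k => R.localFrame β Ω W (ε k), fun k => ?mem, fun x hx => ?independent,
    fun τ hτ => ⟨fun k => R.localCoeff κ Ω W τ (ε k), fun k => ?smooth, fun x hx => ?sum⟩⟩
  case mem => exact ⟨R.isSmoothBiForm_localFrame hΩ hW hβ _, fun x => R.localFrame_mem (hβX x) _⟩
  case independent => exact (R.linearIndependent_localFrame (hΩ0 x hx) hx).comp ε ε.injective
  case smooth =>
    exact R.contMDiffOn_localCoeff hΩ hW hU (hκ.mono (Set.subset_univ U)) hΩU (fun _ => id) hτ.1 _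
  case sum =>
    rw [ε.sum_comp fun z => R.localCoeff κ Ω W τ z x • R.localFrame β Ω W z x]
    exact (R.sum_localCoeff_smul_localFrame (hΩ0 x hx) hx (hβX x) (hτ.2 x)).symm

end NullFrame

end LocalFrame

/-! ### Components at a point -/

section MainTheorem

theorem exists_uniform_triangular_completion (ι : Type*) [Fintype ι] [LinearOrder ι] :
    ∃ f : Matrix ι ι ℝ → ι → ι → ((({p : ι × ι // p.1 < p.2} → ℝ) × (ι → ℝ)) →ₗ[ℝ] ℝ),
      ∀ g : Matrix ι ι ℝ, g.IsSymm → IsAnisotropic g → ∀ Z : Matrix ι ι ℝ, (g * Z).IsSymm ↔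
        ∀ i j, i < j → Z j i = f g i j (fun p => Z p.1.1 p.1.2, fun i => -Z i i) := by
  have h (g : Matrix ι ι ℝ) :
      ∃ f : ι → ι → ((({p : ι × ι // p.1 < p.2} → ℝ) × (ι → ℝ)) →ₗ[ℝ] ℝ),
        g.IsSymm → IsAnisotropic g → ∀ Z : Matrix ι ι ℝ, (g * Z).IsSymm ↔
          ∀ i j, i < j → Z j i = f i j (fun p => Z p.1.1 p.1.2, fun i => -Z i i) := by
    by_cases hg : g.IsSymm ∧ IsAnisotropic g
    · obtain ⟨f, hf⟩ := exists_triangular_completion hg.1 hg.2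
      refine ⟨fun i j => f i j ∘ₗ LinearMap.prodMap LinearMap.id (-LinearMap.id), fun _ _ Z => ?_⟩
      rw [hf]
      refine forall₃_congr fun i j _ => ?_
      rw [LinearMap.comp_apply, LinearMap.prodMap_apply]
      exact Eq.congr_right <| congrArg (f i j) <|
        Prod.ext rfl (funext fun k => (neg_neg (Z k k)).symm)
    · exact ⟨0, fun h_symm h_aniso => absurd ⟨h_symm, h_aniso⟩ hg⟩
  choose f hf using h
  exact ⟨f, hf⟩

variable {n : ℕ} {M : Type*} [TopologicalSpace M]
  [ChartedSpace (EuclideanSpace ℝ (Fin (n + 3))) M] [IsManifold (𝓡 (n + 3)) ∞ M]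
  {F : Type*} [NormedAddCommGroup F] [NormedSpace ℝ F]
  {E : M → Type*} [TopologicalSpace (TotalSpace F E)] [∀ x, AddCommGroup (E x)]
  [∀ x, Module ℝ (E x)] [∀ x, TopologicalSpace (E x)] [∀ x, IsTopologicalAddGroup (E x)]
  [∀ x, ContinuousSMul ℝ (E x)] [FiberBundle F E] [VectorBundle ℝ F E]
  [ContMDiffVectorBundle ∞ F E (𝓡 (n + 3))]

namespace NullFrame

variable {D : BoundaryCoframe n M F E} (R : NullFrame D)
  (β : ∀ x : M, TangentSpace (𝓡 (n + 3)) x →L[ℝ] ℝ) {q : M}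

theorem modifiedMetric_submatrix_castSucc (d : Fin (n + 3) → TangentSpace (𝓡 (n + 3)) q) :
    (R.modifiedMetric β q d).submatrix Fin.castSucc Fin.castSucc =
      gram (D.metricL q) (D.coframeL q) fun j => d j.castSucc :=
  Matrix.ext fun _ _ => (R.isLightLike q).metric_transverseCoframe _ _ _

variable {R β}

theorem mem_fibreS_iff_component (hβX : β q (R.X q) = 1)
    {d : Fin (n + 3) → TangentSpace (𝓡 (n + 3)) q} (h_null : D.IsNull q (d (Fin.last (n + 2))))
    {b : Basis (Fin (n + 4)) ℝ (E q)} (hb : ∀ i : Fin (n + 3), b i.castSucc = D.coframe q (d i))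
    (hb_last : ∀ u, D.metric q (b (Fin.last (n + 3))) (R.modifiedCoframe β q u) = 0)
    {f : Matrix (Fin (n + 2)) (Fin (n + 2)) ℝ → Fin (n + 2) → Fin (n + 2) →
        ((({p : Fin (n + 2) × Fin (n + 2) // p.1 < p.2} → ℝ) × (Fin (n + 2) → ℝ)) →ₗ[ℝ] ℝ)}
    (hf : ∀ g, g.IsSymm → IsAnisotropic g → ∀ Z, (g * Z).IsSymm ↔
      ∀ i j, i < j → Z j i = f g i j (fun p => Z p.1.1 p.1.2, fun i => -Z i i))
    (τ : BiForm (TangentSpace (𝓡 (n + 3)) q) (E q) (n + 1) (n + 3)) :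
    τ ∈ R.fibreS β q ↔
      (∀ I J, component d b τ I J ≠ 0 → IsXYIndex I J) ∧ ∑ μ, compY d b τ μ = 0 ∧
      ∀ μ₁ μ₂ : Fin (n + 2), μ₁ < μ₂ → compX d b τ μ₁ μ₂ =
        f ((R.modifiedMetric β q d).submatrix Fin.castSucc Fin.castSucc) μ₁ μ₂
          (fun p => compX d b τ p.1.2 p.1.1, compY d b τ) := by
  have h_indep : LinearIndependent ℝ d := by
    have h := b.linearIndependent.comp _ (Fin.castSucc_injective _)
    rw [show ⇑b ∘ Fin.castSucc = D.coframeL q ∘ d from funext hb] at h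
    exact h.of_comp
  obtain ⟨d, rfl⟩ : ∃ d' : Basis (Fin (n + 3)) ℝ (TangentSpace (𝓡 (n + 3)) q), ⇑d' = d :=
    ⟨basisOfLinearIndependentOfCardEqFinrank h_indep
      (by rw [finrank_tangentSpace_eq, Fintype.card_fin]),
      coe_basisOfLinearIndependentOfCardEqFinrank _ _⟩
  have h_ne := d.ne_zero (Fin.last (n + 2))
  have h : IsLightLike (n + 3) (D.metricL q) (D.coframeL q) (d (Fin.last (n + 2))) :=
    (R.isLightLike q).of_null h_ne h_null
  obtain ⟨γ, hγ, h_coframe⟩ := (R.isLightLike q).exists_transverseCoframe_eq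
    (β := (β q : TangentSpace (𝓡 (n + 3)) q →ₗ[ℝ] ℝ)) hβX h_ne h_null
  have h_fibre : R.fibreS β q = degeneracyFibre n (D.metricL q) (D.coframeL q)
      (transverseCoframe (D.coframeL q) γ (d (Fin.last (n + 2)))) :=
    congrArg (degeneracyFibre n (D.metricL q) (D.coframeL q)) h_coframe.symm
  have h_aniso : IsAnisotropic
      (gram (D.metricL q) (D.coframeL q) fun j : Fin (n + 2) => d j.castSucc) :=
    h.gram_isAnisotropic (coe_reindex_finRotate d ▸ (d.reindex (finRotate _)).linearIndependent)
  rw [h_fibre, modifiedMetric_submatrix_castSucc]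
  exact h.mem_degeneracyFibre_iff_component hγ hb
    (fun u => by rw [h_coframe]; exact hb_last u) (hf _ h.gram_isSymm h_aniso) τ

end NullFrame

end MainTheorem

theorem mainTheorem4_general (n : ℕ) :
    ∃ f : Matrix (Fin (n + 3)) (Fin (n + 3)) ℝ → Fin (n + 2) → Fin (n + 2) →
        ((({p : Fin (n + 2) × Fin (n + 2) // p.1 < p.2} → ℝ) × (Fin (n + 2) → ℝ)) →ₗ[ℝ] ℝ),
    ∀ (M : Type*) [TopologicalSpace M] [T2Space M]
      [ChartedSpace (EuclideanSpace ℝ (Fin (n + 3))) M] [IsManifold (𝓡 (n + 3)) ∞ M]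
      (F : Type*) [NormedAddCommGroup F] [NormedSpace ℝ F]
      (E : M → Type*) [TopologicalSpace (TotalSpace F E)] [∀ x, AddCommGroup (E x)]
      [∀ x, Module ℝ (E x)] [∀ x, TopologicalSpace (E x)] [∀ x, IsTopologicalAddGroup (E x)]
      [∀ x, ContinuousSMul ℝ (E x)] [FiberBundle F E] [VectorBundle ℝ F E]
      [ContMDiffVectorBundle ∞ F E (𝓡 (n + 3))]
      (D : BoundaryCoframe n M F E) (R : NullFrame D)
      (β : ∀ x : M, TangentSpace (𝓡 (n + 3)) x →L[ℝ] ℝ), IsSmoothOneForm n M β →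
      (∀ x, β x (R.X x) = 1) →
      IsLocallyFreeOfRank (R.spaceS β) ((n + 4) * (n + 1) / 2) ∧
      (∀ x, finrank ℝ (R.fibreS β x) = (n + 4) * (n + 1) / 2) ∧
      ∀ (q : M) (d : Fin (n + 3) → TangentSpace (𝓡 (n + 3)) q),
        D.IsNull q (d (Fin.last (n + 2))) →
        ∀ b : Basis (Fin (n + 4)) ℝ (E q),
          (∀ i : Fin (n + 3), b i.castSucc = D.coframe q (d i)) →
          (∀ u, D.metric q (b (Fin.last (n + 3))) (R.modifiedCoframe β q u) = 0) →
          ∀ τ : BiForm (TangentSpace (𝓡 (n + 3)) q) (E q) (n + 1) (n + 3),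
            τ ∈ R.fibreS β q ↔
              (∀ I J, component d b τ I J ≠ 0 → IsXYIndex I J) ∧
              ∑ μ, compY d b τ μ = 0 ∧
              ∀ μ₁ μ₂ : Fin (n + 2), μ₁ < μ₂ →
                compX d b τ μ₁ μ₂ = f (R.modifiedMetric β q d) μ₁ μ₂
                  (fun p => compX d b τ p.1.2 p.1.1, compY d b τ) := by
  obtain ⟨f, hf⟩ := exists_uniform_triangular_completion (Fin (n + 2))
  refine ⟨fun G => f (G.submatrix Fin.castSucc Fin.castSucc), ?_⟩
  intro M _ _ _ _ F _ _ E _ _ _ _ _ _ _ _ _ D R β hβ hβX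
  exact ⟨R.isLocallyFreeOfRank_spaceS hβ hβX, fun x => R.finrank_fibreS (hβX x),
    fun q _ h_null _ hb hb_last τ =>
      NullFrame.mem_fibreS_iff_component (hβX q) h_null hb hb_last hf τ⟩

theorem mainTheorem4 (n : ℕ) :
    ∃ f : Matrix (Fin (n + 3)) (Fin (n + 3)) ℝ → Fin (n + 2) → Fin (n + 2) →
        ((({p : Fin (n + 2) × Fin (n + 2) // p.1 < p.2} → ℝ) × (Fin (n + 2) → ℝ)) →ₗ[ℝ] ℝ),
    ∀ (M : Type*) [TopologicalSpace M] [T2Space M]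
      [ChartedSpace (EuclideanSpace ℝ (Fin (n + 3))) M] [IsManifold (𝓡 (n + 3)) ∞ M]
      (F : Type*) [NormedAddCommGroup F] [NormedSpace ℝ F]
      (E : M → Type*) [TopologicalSpace (TotalSpace F E)] [∀ x, AddCommGroup (E x)]
      [∀ x, Module ℝ (E x)] [∀ x, TopologicalSpace (E x)] [∀ x, IsTopologicalAddGroup (E x)]
      [∀ x, ContinuousSMul ℝ (E x)] [FiberBundle F E] [VectorBundle ℝ F E]
      [ContMDiffVectorBundle ∞ F E (𝓡 (n + 3))]
      (D : BoundaryCoframe n M F E) (R : NullFrame D)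
      (β : ∀ x : M, TangentSpace (𝓡 (n + 3)) x →L[ℝ] ℝ), R.IsNormalising β →
      -- the rank of `𝒮` is `N (N - 3) / 2`
      IsLocallyFreeOfRank (R.spaceS β) ((n + 4) * (n + 1) / 2) ∧
      (∀ x, Module.finrank ℝ (R.fibreS β x) = (n + 4) * (n + 1) / 2) ∧
      -- the components of the elements of `𝒮` at a point `q` in local coordinates
      ∀ φ ∈ IsManifold.maximalAtlas (𝓡 (n + 3)) ∞ M, ∀ q ∈ φ.source,
        D.IsNull q (coordVector φ q (Fin.last (n + 2))) →
        ∀ b : Module.Basis (Fin (n + 4)) ℝ (E q),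
          (∀ i : Fin (n + 3), b i.castSucc = D.coframe q (coordVector φ q i)) →
          (∀ u, D.metric q (b (Fin.last (n + 3))) (R.modifiedCoframe β q u) = 0) →
          ∀ τ : BiForm (TangentSpace (𝓡 (n + 3)) q) (E q) (n + 1) (n + 3),
            τ ∈ R.fibreS β q ↔
              (∀ I J, component (coordVector φ q) b τ I J ≠ 0 → IsXYIndex I J) ∧
              ∑ μ, compY (coordVector φ q) b τ μ = 0 ∧
              ∀ μ₁ μ₂ : Fin (n + 2), μ₁ < μ₂ →
                compX (coordVector φ q) b τ μ₁ μ₂ =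
                  f (R.modifiedMetric β q (coordVector φ q)) μ₁ μ₂
                    (fun p => compX (coordVector φ q) b τ p.1.2 p.1.1,
                      compY (coordVector φ q) b τ) := by
  obtain ⟨f, hf⟩ := mainTheorem4_general n
  refine ⟨f, fun M _ _ _ _ F _ _ E _ _ _ _ _ _ _ _ _ D R β hβ => ?_⟩
  obtain ⟨h_free, h_rank, h_comp⟩ := hf M F E D R β hβ.smooth hβ.apply_X
  exact ⟨h_free, h_rank, fun φ _ q _ => h_comp q (coordVector φ q)⟩
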